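/- Let $S^1=\mathbb R/\mathbb Z$, let $\alpha$ be irrational, and let $a,b\in S^1$ lie in different orbits of the rotation $R_\alpha(y)=y+\alpha$. A homeomorphism $f$ of $S^1$ is a *Denjoy homeomorphism blowing up the orbits of $a$ and $b$* if there is a continuous monotone degree-one map $\pi:S^1\to S^1$ with $\pi\circ f=R_\alpha\circ\pi$ such that the intervals $I_n=\pi^{-1}(a+n\alpha)$ and $J_n=\pi^{-1}(b+n\alpha)$, $n\in\mathbb Z$, are nondegenerate, while every other fibre of $\pi$ is a single point. Such $f$ exist. For any such $f$, put $$K=S^1\setminus\bigcup_n(\operatorname{int} I_n\cup\operatorname{int} J_n),\qquad C_1=K\cup\bigcup_n I_n,\qquad C_2=K\cup\bigcup_n J_n .$$ Then $K$ is a Cantor set, $f(K)=K$ and $f$ is minimal on $K$; the $I_n,J_n$ are pairwise disjoint closed arcs with $f(I_n)=I_{n+1}$, $f(J_n)=J_{n+1}$; and $C_1,C_2$ are Cantorvals (nonempty proper compact sets that are the closure of their interior and in which the endpoints of every nontrivial component are accumulated by one-point components). Let $v$ be a continuous vector field on $S^1$ that generates a flow, is nonzero on $\operatorname{int} I_0\cup\operatorname{int}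 J_0$ and vanishes elsewhere, and let $f_1$ and $f_2$ be its time $1$ and time $-\sqrt2$ maps. Choose three intervals $I_{i'}=[p_1,p_2]$, $J_k=[q_1,q_2]$, $I_{i''}=[p_1',p_2']$ that are disjoint and in this cyclic order, and a homeomorphism $g$ of $S^1$ with $$g(p_1)=p_1,\qquad g(p_2')=p_2',\qquad g([p_2,p_1'])\subset J_k,$$ which is the identity outside the arc $[p_1,p_2']$. Such choices exist ($v$ can even be taken Lipschitz; such intervals exist, and for every such triple of intervals there is such a $g$). For all such choices let $G=\langle f,f^{-1},f_1,f_2,g\rangle_+$ be the generated semigroup. Call a nonempty closed set $M$ forward-minimal if $h(M)\subset M$ for all $h\in G$ and no nonempty closed proper subset of $M$ has this property; call it backward-minimal if the same holds with $h^{-1}$ in place of $h$. Then $g(C_2)\subset C_2$ and $g(C_1)\supset C_1$; the unique forward-minimal set is $\mathcal M_+=C_2$ and the unique backward-minimal set is $\mathcal M_-=C_1$; the closure of the forward orbit $\{h(x):h\in G\}$ of every $x\in S^1$ contains $C_2$, and the closure of the backward orbit $\{h^{-1}(x):h\in G\}$ of every $x\in S^1$ contains $C_1$. In particular neither of $\mathcal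 M_+,\mathcal M_-$ is contained in the other, and the action of $G$ is neither forward nor backward minimal ($S^1$ is neither a forward-minimal nor a backward-minimal set). -/

import Mathlib

open Set Filter Topology

/-- `f` is a Denjoy homeomorphism of the circle `ℝ / ℤ`, obtained by blowing up the orbits of `a` and
of `b` under the rotation by `α`: the map `p` that collapses the glued intervals is a continuous
monotone map of degree one (it has a continuous monotone lift commuting with the unit translation),
it semiconjugates `f` to the rotation, its fibres over the two orbits are nondegenerate, and all its
other fibres are points. -/
structure IsDenjoyBlowUp (α : ℝ) (a b : UnitAddCircle) (f : UnitAddCircle ≃ₜ UnitAddCircle)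
    (p : UnitAddCircle → UnitAddCircle) : Prop where
  exists_lift : ∃ F : CircleDeg1Lift, Continuous F ∧ ∀ t : ℝ, p (t : UnitAddCircle) = (F t : ℝ)
  semiconj : ∀ x, p (f x) = p x + (α : UnitAddCircle)
  fibre_nontrivial : ∀ n : ℤ, (p ⁻¹' {a + n • (α : UnitAddCircle)}).Nontrivial ∧
    (p ⁻¹' {b + n • (α : UnitAddCircle)}).Nontrivial
  fibre_subsingleton : ∀ y : UnitAddCircle,
    (∀ n : ℤ, y ≠ a + n • (α : UnitAddCircle) ∧ y ≠ b + n • (α : UnitAddCircle)) →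
      (p ⁻¹' {y}).Subsingleton

/-- The family of closed intervals glued in place of the orbit `c + n • α`. -/
def blownInterval (p : UnitAddCircle → UnitAddCircle) (α : ℝ) (c : UnitAddCircle) (n : ℤ) :
    Set UnitAddCircle :=
  p ⁻¹' {c + n • (α : UnitAddCircle)}

/-- The image in the circle of the real segment `[s, t]`; for `s < t < s + 1` this is the closed arc
going from `s` to `t` in the positive direction. -/
def arc (s t : ℝ) : Set UnitAddCircle :=
  (fun x : ℝ => (x : UnitAddCircle)) '' Icc s t

/-- The circle without the open intervals `int I n` and `int J n`. -/
def denjoySet (I J : ℤ → Set UnitAddCircle) : Set UnitAddCircle :=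
  (⋃ n, interior (I n) ∪ interior (J n))ᶜ

/-- A Cantor set: nonempty, compact, perfect, totally disconnected. -/
def IsCantorSet {X : Type*} [TopologicalSpace X] (C : Set X) : Prop :=
  C.Nonempty ∧ IsCompact C ∧ Perfect C ∧ IsTotallyDisconnected C

/-- A (symmetric) Cantorval in a one-dimensional space: a nonempty proper compact set that is the
closure of its interior and in which the endpoints of every nontrivial component are accumulated by
one-point components. -/
def IsCantorval {X : Type*} [TopologicalSpace X] (C : Set X) : Prop :=
  C.Nonempty ∧ C ≠ univ ∧ IsCompact C ∧ closure (interior C) = C ∧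
    ∀ x ∈ C, (connectedComponentIn C x).Nontrivial →
      ∀ y ∈ frontier (connectedComponentIn C x),
        AccPt y (𝓟 {z | z ∈ C ∧ connectedComponentIn C z = {z}})

/-- `M` is a minimal set of the family `A` of homeomorphisms: it is nonempty, closed and invariant
(`h(M) ⊆ M` for all `h ∈ A`), and no smaller set is. -/
def IsMinimalSet {X : Type*} [TopologicalSpace X] (A : Set (X ≃ₜ X)) (M : Set X) : Prop :=
  Minimal (fun N : Set X => N.Nonempty ∧ IsClosed N ∧ ∀ h ∈ A, h '' N ⊆ N) M

/-- Forward-minimal sets of a semigroup of homeomorphisms. -/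
def IsForwardMinimal {X : Type*} [TopologicalSpace X] (G : Subsemigroup (X ≃ₜ X))
    (M : Set X) : Prop :=
  IsMinimalSet {h | h ∈ G} M

/-- Backward-minimal sets of a semigroup `G`: the minimal sets of the inverses of its elements. -/
def IsBackwardMinimal {X : Type*} [TopologicalSpace X] (G : Subsemigroup (X ≃ₜ X))
    (M : Set X) : Prop :=
  IsMinimalSet {h | h⁻¹ ∈ G} M

/-- The flow `φ` on the circle is generated by the vector field `v`: every trajectory lifts to a
solution of `γ' = v(γ)` on the line. -/
def IsFlowOf (v : UnitAddCircle → ℝ) (φ : Flow ℝ UnitAddCircle) : Prop :=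
  ∀ x : UnitAddCircle, ∃ γ : ℝ → ℝ, (∀ t, (γ t : UnitAddCircle) = φ t x) ∧
    ∀ t, HasDerivAt γ (v (γ t : UnitAddCircle)) t

/-- `[p₁, p₂]`, `[q₁, q₂]`, `[p₁', p₂']` are the intervals `I i'`, `J k`, `I i''`, disjoint and in
this cyclic order on the circle. -/
structure IsCyclicTriple (I J : ℤ → Set UnitAddCircle) (i' k i'' : ℤ)
    (p₁ p₂ q₁ q₂ p₁' p₂' : ℝ) : Prop where
  lt₁ : p₁ < p₂
  lt₂ : p₂ < q₁
  lt₃ : q₁ < q₂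
  lt₄ : q₂ < p₁'
  lt₅ : p₁' < p₂'
  lt₆ : p₂' < p₁ + 1
  first : I i' = arc p₁ p₂
  middle : J k = arc q₁ q₂
  last : I i'' = arc p₁' p₂'

/-- The conditions on the additional generator `g`: it fixes `p₁` and `p₂'`, it sends the arc
`[p₂, p₁']` into the interval `Jk`, and it is the identity outside the arc `[p₁, p₂']`. -/
structure IsPushMap (Jk : Set UnitAddCircle) (p₁ p₂ p₁' p₂' : ℝ)
    (g : UnitAddCircle ≃ₜ UnitAddCircle) : Prop where
  fix_left : g (p₁ : UnitAddCircle) = (p₁ : UnitAddCircle)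
  fix_right : g (p₂' : UnitAddCircle) = (p₂' : UnitAddCircle)
  maps_into : g '' arc p₂ p₁' ⊆ Jk
  eq_id : ∀ x, x ∉ arc p₁ p₂' → g x = x

/-- The semigroup `⟨f, f⁻¹, f₁, f₂, g⟩₊`. -/
def exampleSemigroup {X : Type*} [TopologicalSpace X] (f f₁ f₂ g : X ≃ₜ X) :
    Subsemigroup (X ≃ₜ X) :=
  Subsemigroup.closure {f, f⁻¹, f₁, f₂, g}

/-! Each Cantorval is the complement of the gaps of the other family: `C₂` is the circle minus all
`interior (I n)`, and `C₁` is the circle minus all `interior (J n)` (`denjoySet_union`). Both are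
preserved by `f` and by the flow. A point of `C₂` moved by `g` lies between the two outer intervals
and lands in `J k`; a point of `interior (J n)` moved by `g` lands in `interior (J k)`. Hence `g`
maps `C₂` into itself and `g '' C₁` contains `C₁`.

Conversely, let `N` be nonempty, closed and forward invariant. Orbits of `f` project to dense
rotation orbits, so `N` contains every point that is alone in its fibre, and hence `K`
(`denjoySet_subset`). Such a point exists between `p₂` and `q₁`, and `g` sends it into `interior (J
k)`. Powers of `f` bring it to `interior (J 0)`, a single trajectory of the flow. Since `1` and
`-√2` generate a dense additive semigroup of the line, `N` fills `J 0`, then every `J n`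
(`union_subset_of_invariant`). For backward invariance, `g⁻¹` expels the same point into `interior
(I i')` or `interior (I i'')`, and the argument gives `C₁`. An invariant closed set contained in all
others is the unique minimal one, and orbit closures are such invariant sets.

For existence, `v` is the distance to the complement of the two open intervals, and `f` comes from
the generalized inverse of a strictly increasing function that jumps exactly at the two orbits. -/

/-! ### Arcs and connected sets in the circle. -/

theorem coe_eq_coe_iff_exists_int {x y : ℝ} :
    (x : UnitAddCircle) = (y : UnitAddCircle) ↔ ∃ m : ℤ, x = y + m := by
  rw [← sub_eq_zero, ← AddCircle.coe_sub, AddCircle.coe_eq_zero_iff]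
  constructor
  · rintro ⟨n, hn⟩
    exact ⟨n, by simp at hn; linarith⟩
  · rintro ⟨m, hm⟩
    exact ⟨m, by simp [hm]⟩

theorem coe_add_int (x : ℝ) (m : ℤ) : ((x + m : ℝ) : UnitAddCircle) = x :=
  coe_eq_coe_iff_exists_int.2 ⟨m, rfl⟩

theorem coe_add_one (x : ℝ) : ((x + 1 : ℝ) : UnitAddCircle) = x :=
  coe_eq_coe_iff_exists_int.2 ⟨1, by simp⟩

theorem isOpenMap_coe_circle : IsOpenMap (fun x : ℝ => (x : UnitAddCircle)) :=
  QuotientAddGroup.isOpenMap_coe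

theorem continuous_coe_circle : Continuous (fun x : ℝ => (x : UnitAddCircle)) :=
  AddCircle.continuous_mk' 1

theorem exists_coe_mem_Ico (c : ℝ) (x : UnitAddCircle) :
    ∃ t ∈ Ico c (c + 1), (t : UnitAddCircle) = x := by
  have : x ∈ (fun t : ℝ => (t : UnitAddCircle)) '' Ico c (c + 1) := by
    have h := AddCircle.coe_image_Ico_eq (1 : ℝ) c
    exact h ▸ mem_univ x
  exact this

theorem isPreconnected_arc (s t : ℝ) : IsPreconnected (arc s t) :=
  isPreconnected_Icc.image _ continuous_coe_circle.continuousOn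

theorem interior_arc {s t : ℝ} (h : t < s + 1) :
    interior (arc s t) = (fun x : ℝ => (x : UnitAddCircle)) '' Ioo s t := by
  apply Subset.antisymm
  · intro x hx
    obtain ⟨y, hy, rfl⟩ := interior_subset hx
    have hpre : ∀ᶠ z : ℝ in 𝓝 y, (z : UnitAddCircle) ∈ arc s t :=
      continuous_coe_circle.continuousAt (mem_interior_iff_mem_nhds.1 hx)
    refine ⟨y, ⟨lt_of_le_of_ne hy.1 ?_, lt_of_le_of_ne hy.2 ?_⟩, rfl⟩
    · rintro rfl
      have h1 : ∀ᶠ z : ℝ in 𝓝[<] s, (z : UnitAddCircle) ∈ arc s t := hpre.filter_mono nhdsWithin_le_nhds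
      -- No integer translate of `[s, t]` meets `(t - 1, s)`, which is nonempty because the arc is
      -- shorter than the circle.
      have h2 : ∀ᶠ z : ℝ in 𝓝[<] s, z ∈ Ioo (t - 1) s := Ioo_mem_nhdsLT (by linarith)
      obtain ⟨z, ⟨w, hw, hwz⟩, hz⟩ := (h1.and h2).exists
      obtain ⟨m, hm⟩ := coe_eq_coe_iff_exists_int.1 hwz
      have h3 : (0 : ℝ) < m := by linarith [hw.1, hz.2]
      have h4 : (m : ℝ) < 1 := by linarith [hw.2, hz.1]
      norm_cast at h3 h4
      omega
    · rintro rfl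
      have h1 : ∀ᶠ z : ℝ in 𝓝[>] y, (z : UnitAddCircle) ∈ arc s y := hpre.filter_mono nhdsWithin_le_nhds
      have h2 : ∀ᶠ z : ℝ in 𝓝[>] y, z ∈ Ioo y (s + 1) := Ioo_mem_nhdsGT (by linarith)
      obtain ⟨z, ⟨w, hw, hwz⟩, hz⟩ := (h1.and h2).exists
      obtain ⟨m, hm⟩ := coe_eq_coe_iff_exists_int.1 hwz
      have h3 : (-1 : ℝ) < m := by linarith [hw.1, hz.2]
      have h4 : (m : ℝ) < 0 := by linarith [hw.2, hz.1]
      norm_cast at h3 h4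
      omega
  · exact interior_maximal (image_mono Ioo_subset_Icc_self) (isOpenMap_coe_circle _ isOpen_Ioo)

theorem arc_subset_closure_interior {s t : ℝ} (hst : s < t) (h : t < s + 1) :
    arc s t ⊆ closure (interior (arc s t)) := by
  rw [interior_arc h, arc, ← closure_Ioo hst.ne]
  exact image_closure_subset_closure_image continuous_coe_circle

/-- A preconnected set with two points contains one of the two arcs between them. -/
theorem IsPreconnected.exists_arc_subset {C : Set UnitAddCircle} (hC : IsPreconnected C)
    {x y : UnitAddCircle} (hx : x ∈ C) (hy : y ∈ C) (hxy : x ≠ y) :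
    ∃ s t : ℝ, s < t ∧ arc s t ⊆ C ∧ (s : UnitAddCircle) ∈ ({x, y} : Set UnitAddCircle) ∧
      (t : UnitAddCircle) ∈ ({x, y} : Set UnitAddCircle) ∧ (s : UnitAddCircle) ≠ t := by
  by_cases hu : C = univ
  · obtain ⟨s, hs, rfl⟩ := exists_coe_mem_Ico 0 x
    obtain ⟨t, ht, rfl⟩ := exists_coe_mem_Ico (s) y
    refine ⟨s, t, lt_of_le_of_ne ht.1 ?_, by simp [hu], by simp, by simp, hxy⟩
    rintro rfl
    exact hxy rfl
  -- Cutting the circle at a missed point `c` reduces the claim to intervals: a second missed point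
  -- `z` would separate `C` by the images of `(c, z)` and `(z, c + 1)`.
  · obtain ⟨c, hc⟩ := (ne_univ_iff_exists_notMem C).1 hu
    obtain ⟨c, -, rfl⟩ := exists_coe_mem_Ico 0 c
    have hlift : ∀ w ∈ C, ∃ t ∈ Ioo c (c + 1), (t : UnitAddCircle) = w := by
      intro w hw
      obtain ⟨t, ht, rfl⟩ := exists_coe_mem_Ico c w
      refine ⟨t, ⟨lt_of_le_of_ne ht.1 ?_, ht.2⟩, rfl⟩
      rintro rfl
      exact hc hw
    have key : ∀ s ∈ Ioo c (c + 1), ∀ t ∈ Ioo c (c + 1), (s : UnitAddCircle) ∈ C →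
        (t : UnitAddCircle) ∈ C → arc s t ⊆ C := by
      rintro s hs t ht hsC htC _ ⟨z, hz, rfl⟩
      by_contra hzC
      have hsz : s < z := lt_of_le_of_ne hz.1 (by rintro rfl; exact hzC hsC)
      have hzt : z < t := lt_of_le_of_ne hz.2 (by rintro rfl; exact hzC htC)
      obtain ⟨w, -, ⟨u, hu, hu'⟩, ⟨v, hv, hv'⟩⟩ := hC _ _
        (isOpenMap_coe_circle _ (isOpen_Ioo (a := c) (b := z)))
        (isOpenMap_coe_circle _ (isOpen_Ioo (a := z) (b := c + 1)))
        (by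
          intro w hw
          obtain ⟨r, hr, rfl⟩ := hlift w hw
          rcases lt_trichotomy r z with h | h | h
          · exact Or.inl ⟨r, ⟨hr.1, h⟩, rfl⟩
          · exact absurd (h ▸ hw) hzC
          · exact Or.inr ⟨r, ⟨h, hr.2⟩, rfl⟩)
        ⟨_, hsC, s, ⟨hs.1, hsz⟩, rfl⟩ ⟨_, htC, t, ⟨hzt, ht.2⟩, rfl⟩
      have huv : u = v := (AddCircle.coe_eq_coe_iff_of_mem_Ico (p := (1 : ℝ)) (a := c)
        ⟨hu.1.le, by linarith [hu.2, hz.2, ht.2]⟩ ⟨by linarith [hv.1, hs.1], hv.2⟩).1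
        (hu'.trans hv'.symm)
      linarith [hu.2, hv.1]
    obtain ⟨s, hs, rfl⟩ := hlift x hx
    obtain ⟨t, ht, rfl⟩ := hlift y hy
    rcases lt_trichotomy s t with h | h | h
    · exact ⟨s, t, h, key s hs t ht hx hy, by simp, by simp, hxy⟩
    · exact absurd (by rw [h]) hxy
    · exact ⟨t, s, h, key t ht s hs hy hx, by simp, by simp, hxy.symm⟩

/-! ### Density of irrational rotations. -/

theorem mapClusterPt_nsmul_of_irrational {α : ℝ} (hα : Irrational α) (x : UnitAddCircle) :
    MapClusterPt x atTop (fun n : ℕ => n • (α : UnitAddCircle)) := by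
  rw [mapClusterPt_atTop_nsmul_iff_mem_topologicalClosure_zmultiples]
  have h : DenseRange (fun n : ℤ => n • (α : UnitAddCircle)) :=
    AddCircle.denseRange_zsmul_coe_iff.2 (by simpa using hα)
  exact h x

/-- Forward orbits of an irrational rotation are dense. -/
theorem denseRange_add_nsmul {α : ℝ} (hα : Irrational α) (c : UnitAddCircle) :
    DenseRange (fun n : ℕ => c + n • (α : UnitAddCircle)) := by
  have h : DenseRange (fun n : ℕ => n • (α : UnitAddCircle)) := by
    intro x
    rw [mem_closure_iff_nhds]
    intro U hU
    obtain ⟨n, hn⟩ := ((mapClusterPt_nsmul_of_irrational hα x).frequently hU).exists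
    exact ⟨_, hn, n, rfl⟩
  exact (Homeomorph.addLeft c).surjective.denseRange.comp h (Homeomorph.addLeft c).continuous

/-- The additive semigroup generated by `1` and `-√2` is dense in the line. -/
theorem exists_nat_sub_mul_sqrt_two (t : ℝ) {ε : ℝ} (hε : 0 < ε) :
    ∃ m n : ℕ, |(m - n * √2 : ℝ) - t| < ε := by
  have hirr : Irrational (-√2) := irrational_sqrt_two.neg
  -- Recurrence of the rotation by `-√2` supplies arbitrarily large `n`. With `n ≥ |t| + 1` and a
  -- window of radius at most `1`, the integer `m = r + n * √2` cannot be negative.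
  have hU : (fun x : ℝ => (x : UnitAddCircle)) '' Ioo (t - min ε 1) (t + min ε 1) ∈
      𝓝 (t : UnitAddCircle) :=
    isOpenMap_coe_circle.image_mem_nhds
      (Ioo_mem_nhds (by linarith [lt_min hε one_pos]) (by linarith [lt_min hε one_pos]))
  have hfreq := (mapClusterPt_nsmul_of_irrational hirr (t : UnitAddCircle)).frequently hU
  obtain ⟨n, ⟨r, hr, hrn⟩, hn⟩ :=
    (hfreq.and_eventually (eventually_ge_atTop ⌈|t| + 1⌉₊)).exists
  have hrn' : (r : UnitAddCircle) = ((n * (-√2) : ℝ) : UnitAddCircle) := by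
    rw [← nsmul_eq_mul, AddCircle.coe_nsmul]
    exact hrn
  obtain ⟨m, hm⟩ := coe_eq_coe_iff_exists_int.1 hrn'
  have h1 : |t| + 1 ≤ n := Nat.ceil_le.1 hn
  have h2 : (n : ℝ) ≤ n * √2 := by
    have : (1 : ℝ) ≤ √2 := by rw [Real.one_le_sqrt]; norm_num
    nlinarith [Nat.cast_nonneg (α := ℝ) n]
  have h3 : (0 : ℝ) ≤ m := by
    have := neg_abs_le t
    linarith [hr.1, min_le_right ε 1]
  lift m to ℕ using (by exact_mod_cast h3)
  refine ⟨m, n, ?_⟩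
  have h4 : (m - n * √2 : ℝ) = r := by rw [hm]; push_cast; ring
  rw [h4, abs_lt]
  constructor <;> linarith [hr.1, hr.2, min_le_left ε 1]

theorem zsmul_coe_injective {α : ℝ} (hα : Irrational α) {m n : ℤ}
    (h : m • (α : UnitAddCircle) = n • (α : UnitAddCircle)) : m = n := by
  rw [← AddCircle.coe_zsmul, ← AddCircle.coe_zsmul] at h
  obtain ⟨k, hk⟩ := coe_eq_coe_iff_exists_int.1 h
  by_contra hmn
  have h0 : ((m - n : ℤ) : ℝ) ≠ 0 := by exact_mod_cast sub_ne_zero.2 hmn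
  refine hα.ne_rat (k / (m - n : ℤ)) ?_
  push_cast at h0 ⊢
  rw [eq_div_iff h0]
  simp only [zsmul_eq_mul] at hk
  linarith

/-! ### Fibres of the collapsing map, the Cantor set and the Cantorvals. -/

/-- The points whose fibre under the collapsing map is not one of the glued intervals. -/
def regularPoints (p : UnitAddCircle → UnitAddCircle) (α : ℝ) (a b : UnitAddCircle) :
    Set UnitAddCircle :=
  {x | ∀ n : ℤ, p x ≠ a + n • (α : UnitAddCircle) ∧ p x ≠ b + n • (α : UnitAddCircle)}

/-- Two orbits are countable, while `[0, 1)` has positive measure. -/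
theorem exists_forall_ne_add_zsmul (α : ℝ) (a b : UnitAddCircle) : ∃ y : UnitAddCircle,
    ∀ n : ℤ, y ≠ a + n • (α : UnitAddCircle) ∧ y ≠ b + n • (α : UnitAddCircle) := by
  by_contra! hcon
  have h1 : (univ : Set UnitAddCircle) ⊆ range (fun n : ℤ => a + n • (α : UnitAddCircle)) ∪
      range (fun n : ℤ => b + n • (α : UnitAddCircle)) := by
    intro y _
    obtain ⟨n, hn⟩ := hcon y
    by_cases h : y = a + n • (α : UnitAddCircle)
    · exact Or.inl ⟨n, h.symm⟩
    · exact Or.inr ⟨n, (hn h).symm⟩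
  have h2 : (univ : Set UnitAddCircle).Countable :=
    ((countable_range _).union (countable_range _)).mono h1
  have h3 : (Ico (0 : ℝ) 1).Countable := by
    refine MapsTo.countable_of_injOn (f := fun x : ℝ => (x : UnitAddCircle))
      (mapsTo_univ _ _) ?_ h2
    intro x hx y hy hxy
    exact (AddCircle.coe_eq_coe_iff_of_mem_Ico (p := (1 : ℝ)) (a := 0)
      (by simpa using hx) (by simpa using hy)).1 hxy
  have h4 := h3.measure_zero MeasureTheory.volume
  simp at h4

namespace IsDenjoyBlowUp

variable {α : ℝ} {a b : UnitAddCircle} {f : UnitAddCircle ≃ₜ UnitAddCircle}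
  {p : UnitAddCircle → UnitAddCircle}

theorem symm (h : IsDenjoyBlowUp α a b f p) : IsDenjoyBlowUp α b a f p :=
  ⟨h.exists_lift, h.semiconj, fun n => (h.fibre_nontrivial n).symm,
    fun y hy => h.fibre_subsingleton y fun n => (hy n).symm⟩

theorem continuous (h : IsDenjoyBlowUp α a b f p) : Continuous p := by
  obtain ⟨F, hF, hp⟩ := h.exists_lift
  have hq : IsQuotientMap (fun x : ℝ => (x : UnitAddCircle)) :=
    isOpenMap_coe_circle.isQuotientMap continuous_coe_circle fun x =>
      (exists_coe_mem_Ico 0 x).imp fun _ ht => ht.2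
  rw [hq.continuous_iff]
  exact (continuous_coe_circle.comp hF).congr fun t => (hp t).symm

theorem isClosed_fibre (h : IsDenjoyBlowUp α a b f p) (y : UnitAddCircle) :
    IsClosed (p ⁻¹' {y}) :=
  isClosed_singleton.preimage h.continuous

theorem surjective (h : IsDenjoyBlowUp α a b f p) : Function.Surjective p := by
  obtain ⟨F, hF, hp⟩ := h.exists_lift
  intro y
  obtain ⟨y, -, rfl⟩ := exists_coe_mem_Ico 0 y
  obtain ⟨t, rfl⟩ := hF.surjective F.tendsto_atTop F.tendsto_atBot y
  exact ⟨t, hp t⟩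

theorem image_fibre (h : IsDenjoyBlowUp α a b f p) (y : UnitAddCircle) :
    f '' (p ⁻¹' {y}) = p ⁻¹' {y + (α : UnitAddCircle)} := by
  ext x
  constructor
  · rintro ⟨z, hz, rfl⟩
    have hz : p z = y := hz
    simp [h.semiconj, hz]
  · intro hx
    refine ⟨f.symm x, ?_, f.apply_symm_apply x⟩
    have h1 := h.semiconj (f.symm x)
    rw [f.apply_symm_apply, show p x = _ from hx] at h1
    exact (add_right_cancel h1).symm

theorem image_blownInterval (h : IsDenjoyBlowUp α a b f p) (c : UnitAddCircle) (n : ℤ) :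
    f '' blownInterval p α c n = blownInterval p α c (n + 1) := by
  rw [blownInterval, h.image_fibre, blownInterval, add_assoc, add_zsmul, one_zsmul]

theorem iterate_apply (h : IsDenjoyBlowUp α a b f p) (n : ℕ) (x : UnitAddCircle) :
    p (f^[n] x) = p x + n • (α : UnitAddCircle) := by
  induction n with
  | zero => simp
  | succ n ih => rw [Function.iterate_succ_apply', h.semiconj, ih, succ_nsmul, add_assoc]

theorem iterate_ne (h : IsDenjoyBlowUp α a b f p) (hα : Irrational α) (n : ℕ)
    (x : UnitAddCircle) : f^[n + 1] x ≠ x := by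
  intro hx
  have h1 := h.iterate_apply (n + 1) x
  rw [hx] at h1
  have h2 : ((n + 1 : ℕ) : ℤ) • (α : UnitAddCircle) = (0 : ℤ) • (α : UnitAddCircle) := by
    rw [natCast_zsmul, zero_zsmul]
    exact (left_eq_add.1 h1)
  have := zsmul_coe_injective hα h2
  omega

theorem iterate_mem_regularPoints (h : IsDenjoyBlowUp α a b f p) {x : UnitAddCircle}
    (hx : x ∈ regularPoints p α a b) (n : ℕ) : f^[n] x ∈ regularPoints p α a b := by
  intro m
  rw [h.iterate_apply]
  have := hx (m - n)
  rw [sub_zsmul, natCast_zsmul] at this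
  refine ⟨fun hm => this.1 ?_, fun hm => this.2 ?_⟩ <;>
  · rw [eq_sub_of_add_eq hm]; abel

/-- The image `p '' N` is compact and contains a forward rotation orbit, so it is the whole circle.
Over a regular value there is only one point that can be the preimage in `N`. Only forward
invariance enters. -/
theorem regularPoints_subset (h : IsDenjoyBlowUp α a b f p) (hα : Irrational α)
    {N : Set UnitAddCircle} (hne : N.Nonempty) (hcl : IsClosed N) (hN : ∀ x ∈ N, f x ∈ N) :
    regularPoints p α a b ⊆ N := by
  obtain ⟨x, hx⟩ := hne
  have hit : ∀ n : ℕ, f^[n] x ∈ N := by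
    intro n
    induction n with
    | zero => exact hx
    | succ n ih => rw [Function.iterate_succ_apply']; exact hN _ ih
  have himg : p '' N = univ := by
    have h1 : IsClosed (p '' N) := (hcl.isCompact.image h.continuous).isClosed
    have h2 : Dense (p '' N) := (denseRange_add_nsmul hα (p x)).mono (by
      rintro _ ⟨n, rfl⟩
      exact ⟨_, hit n, h.iterate_apply n x⟩)
    rw [← h1.closure_eq, h2.closure_eq]
  intro d hd
  obtain ⟨z, hz, hzd⟩ : p d ∈ p '' N := himg ▸ mem_univ _
  exact h.fibre_subsingleton (p d) hd hzd rfl ▸ hz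

/-- The complement of the two orbits is invariant under the rotation, so it contains the dense
forward orbit of any of its points. -/
theorem dense_off_orbits (hα : Irrational α) : Dense {y : UnitAddCircle |
    ∀ n : ℤ, y ≠ a + n • (α : UnitAddCircle) ∧ y ≠ b + n • (α : UnitAddCircle)} := by
  obtain ⟨y, hy⟩ := exists_forall_ne_add_zsmul α a b
  refine (denseRange_add_nsmul hα y).mono ?_
  rintro _ ⟨n, rfl⟩ m
  have := hy (m - n)
  rw [sub_zsmul, natCast_zsmul] at this
  refine ⟨fun hm => this.1 ?_, fun hm => this.2 ?_⟩ <;>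
  · rw [eq_sub_of_add_eq hm]; abel

theorem exists_lift_coe_mem {F : CircleDeg1Lift} (hF : Continuous F)
    (hp : ∀ t : ℝ, p (t : UnitAddCircle) = (F t : ℝ)) {S : Set UnitAddCircle} (hS : Dense S)
    {s t : ℝ} (hst : F s < F t) :
    ∃ z ∈ Ioo s t, F z ∈ Ioo (F s) (F t) ∧ p (z : UnitAddCircle) ∈ S := by
  have hd : Dense ((fun x : ℝ => (x : UnitAddCircle)) ⁻¹' S) := hS.preimage isOpenMap_coe_circle
  obtain ⟨Y, hYS, hY⟩ := hd.exists_between hst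
  have hle : s ≤ t := (F.monotone.reflect_lt hst).le
  obtain ⟨z, hz, rfl⟩ := intermediate_value_Ioo hle hF.continuousOn hY
  exact ⟨z, hz, hY, by rw [hp]; exact hYS⟩

theorem exists_regularPoint_mem_Ioo (hα : Irrational α) {F : CircleDeg1Lift} (hF : Continuous F)
    (hp : ∀ t : ℝ, p (t : UnitAddCircle) = (F t : ℝ)) {s t : ℝ} (hst : F s < F t) :
    ∃ z ∈ Ioo s t, (z : UnitAddCircle) ∈ regularPoints p α a b := by
  obtain ⟨z, hz, -, hzS⟩ := exists_lift_coe_mem hF hp (dense_off_orbits (a := a) (b := b) hα) hst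
  exact ⟨z, hz, hzS⟩

theorem fibre_eq_image {F : CircleDeg1Lift}
    (hp : ∀ t : ℝ, p (t : UnitAddCircle) = (F t : ℝ)) (Y : ℝ) :
    p ⁻¹' {(Y : UnitAddCircle)} = (fun x : ℝ => (x : UnitAddCircle)) '' (F ⁻¹' {Y}) := by
  ext x
  constructor
  · obtain ⟨t, -, rfl⟩ := exists_coe_mem_Ico 0 x
    intro hx
    have hx : p (t : UnitAddCircle) = (Y : UnitAddCircle) := hx
    rw [hp] at hx
    obtain ⟨m, hm⟩ := coe_eq_coe_iff_exists_int.1 hx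
    refine ⟨t - m, ?_, ?_⟩
    · simp [hm]
    · exact coe_eq_coe_iff_exists_int.2 ⟨-m, by push_cast; ring⟩
  · rintro ⟨t, rfl, rfl⟩
    exact hp t

theorem exists_fibre_eq_Icc {F : CircleDeg1Lift} (hF : Continuous F)
    (hp : ∀ t : ℝ, p (t : UnitAddCircle) = (F t : ℝ)) {Y : ℝ}
    (hY : (p ⁻¹' {(Y : UnitAddCircle)}).Nontrivial) :
    ∃ s t : ℝ, s < t ∧ t < s + 1 ∧ F ⁻¹' {Y} = Icc s t ∧
      p ⁻¹' {(Y : UnitAddCircle)} = arc s t := by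
  rw [fibre_eq_image hp] at hY ⊢
  have hcl : IsClosed (F ⁻¹' {Y}) := isClosed_singleton.preimage hF
  obtain ⟨_, ⟨x, hx, rfl⟩, _, ⟨y, hy, rfl⟩, hxy'⟩ := hY
  have hxy : x ≠ y := fun h => hxy' (by rw [h])
  -- A level set of `F` is shorter than a period, because `F` gains `1` over each period.
  have hF1 : ∀ u ∈ F ⁻¹' {Y}, ∀ v ∈ F ⁻¹' {Y}, u < v + 1 := by
    intro u hu v hv
    by_contra! hlt
    have h1 := F.monotone hlt
    rw [F.map_add_one, show F u = Y from hu, show F v = Y from hv] at h1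
    linarith
  have hba : BddAbove (F ⁻¹' {Y}) := ⟨x + 1, fun u hu => (hF1 u hu x hx).le⟩
  have hbb : BddBelow (F ⁻¹' {Y}) := ⟨x - 1, fun u hu => by linarith [hF1 x hx u hu]⟩
  have hne : (F ⁻¹' {Y}).Nonempty := ⟨x, hx⟩
  have hinf := hcl.csInf_mem hne hbb
  have hsup := hcl.csSup_mem hne hba
  have hIcc : F ⁻¹' {Y} = Icc (sInf (F ⁻¹' {Y})) (sSup (F ⁻¹' {Y})) := by
    apply Subset.antisymm
    · exact fun u hu => ⟨csInf_le hbb hu, le_csSup hba hu⟩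
    · intro u hu
      have h1 := F.monotone hu.1
      have h2 := F.monotone hu.2
      rw [show F (sInf _) = Y from hinf] at h1
      rw [show F (sSup _) = Y from hsup] at h2
      exact le_antisymm h2 h1
  refine ⟨_, _, ?_, hF1 _ hsup _ hinf, hIcc, by rw [arc, ← hIcc]⟩
  rcases lt_or_gt_of_ne hxy with h | h
  · exact (csInf_le hbb hx).trans_lt (h.trans_le (le_csSup hba hy))
  · exact (csInf_le hbb hy).trans_lt (h.trans_le (le_csSup hba hx))

theorem exists_blownInterval_eq_arc (h : IsDenjoyBlowUp α a b f p) (n : ℤ) :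
    ∃ s t : ℝ, s < t ∧ t < s + 1 ∧ blownInterval p α a n = arc s t := by
  obtain ⟨F, hF, hp⟩ := h.exists_lift
  obtain ⟨Y, -, hY⟩ := exists_coe_mem_Ico 0 (a + n • (α : UnitAddCircle))
  have h1 := (h.fibre_nontrivial n).1
  rw [← hY] at h1
  obtain ⟨s, t, hst, hts, -, heq⟩ := exists_fibre_eq_Icc hF hp h1
  exact ⟨s, t, hst, hts, by rw [blownInterval, ← hY, heq]⟩

theorem exists_interior_mem_Ioo (h : IsDenjoyBlowUp α a b f p) (hα : Irrational α)
    {F : CircleDeg1Lift} (hF : Continuous F)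
    (hp : ∀ t : ℝ, p (t : UnitAddCircle) = (F t : ℝ)) {s t : ℝ} (hst : F s < F t) :
    ∃ z ∈ Ioo s t, ∃ n, (z : UnitAddCircle) ∈ interior (blownInterval p α a n) := by
  obtain ⟨z, hz, hFz, n, hn⟩ := exists_lift_coe_mem hF hp (denseRange_add_nsmul hα a) hst
  have hn' : a + (n : ℤ) • (α : UnitAddCircle) = (F z : ℝ) := by
    rw [natCast_zsmul, ← hp]; exact hn
  have h1 := (h.fibre_nontrivial n).1
  rw [hn'] at h1
  obtain ⟨s', t', hst', hts', hIcc, heq⟩ := exists_fibre_eq_Icc hF hp h1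
  have hmem : ∀ u ∈ Icc s' t', F u = F z := fun u hu => by
    rw [← hIcc] at hu; exact hu
  have hs := hmem s' (left_mem_Icc.2 hst'.le)
  have ht := hmem t' (right_mem_Icc.2 hst'.le)
  -- The value `F z` lies strictly between `F s` and `F t`, so the entire fibre `[s', t']` is inside
  -- `(s, t)` and its midpoint can be used.
  have h2 : s < s' := F.monotone.reflect_lt (hs ▸ hFz.1)
  have h3 : t' < t := F.monotone.reflect_lt (ht ▸ hFz.2)
  refine ⟨(s' + t') / 2, ⟨by linarith, by linarith⟩, n, ?_⟩
  rw [blownInterval, hn', heq, interior_arc hts']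
  exact ⟨_, ⟨by linarith, by linarith⟩, rfl⟩

theorem regularPoints_subset_denjoySet :
    regularPoints p α a b ⊆ denjoySet (blownInterval p α a) (blownInterval p α b) := by
  intro x hx hmem
  obtain ⟨n, hn | hn⟩ := mem_iUnion.1 hmem
  · exact (hx n).1 (show x ∈ blownInterval p α a n from interior_subset hn)
  · exact (hx n).2 (show x ∈ blownInterval p α b n from interior_subset hn)

theorem isClosed_denjoySet (I J : ℤ → Set UnitAddCircle) : IsClosed (denjoySet I J) :=
  (isOpen_iUnion fun _ => isOpen_interior.union isOpen_interior).isClosed_compl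

/-- A nondegenerate segment on which the lift is constant covers interior points of a fibre. -/
theorem exists_mem_interior_of_lift_eq (h : IsDenjoyBlowUp α a b f p)
    {F : CircleDeg1Lift} (hp : ∀ t : ℝ, p (t : UnitAddCircle) = (F t : ℝ)) {s t x : ℝ}
    (hx : x ∈ Ioo s t) (hF : F s = F t) : ∃ n,
      (x : UnitAddCircle) ∈ interior (blownInterval p α a n) ∪ interior (blownInterval p α b n) := by
  have hsub : (fun u : ℝ => (u : UnitAddCircle)) '' Ioo s t ⊆ p ⁻¹' {((F s : ℝ) : UnitAddCircle)} := by
    rintro _ ⟨u, hu, rfl⟩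
    have : F u = F s := le_antisymm (hF ▸ F.monotone hu.2.le) (F.monotone hu.1.le)
    simp [hp, this]
  have hint : (x : UnitAddCircle) ∈ interior (p ⁻¹' {((F s : ℝ) : UnitAddCircle)}) :=
    interior_maximal hsub (isOpenMap_coe_circle _ isOpen_Ioo) ⟨x, hx, rfl⟩
  by_contra! hcon
  have hreg : ∀ n : ℤ, ((F s : ℝ) : UnitAddCircle) ≠ a + n • (α : UnitAddCircle) ∧
      ((F s : ℝ) : UnitAddCircle) ≠ b + n • (α : UnitAddCircle) := by
    intro n
    refine ⟨fun hn => hcon n (Or.inl ?_), fun hn => hcon n (Or.inr ?_)⟩ <;>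
    · rw [blownInterval, ← hn]; exact hint
  have hsing := (h.fibre_subsingleton _ hreg).anti hsub
  -- The second point is taken less than one period from `x`, so that it stays distinct from `x` on
  -- the circle.
  have hx1 : x < min t (x + 1) := lt_min hx.2 (by linarith)
  have hy : (x + min t (x + 1)) / 2 ∈ Ioo s t :=
    ⟨by linarith [hx.1], by linarith [min_le_left t (x + 1), hx.2]⟩
  have heq := hsing ⟨x, hx, rfl⟩ ⟨_, hy, rfl⟩
  have := (AddCircle.coe_eq_coe_iff_of_mem_Ico (p := (1 : ℝ)) (a := x) ⟨le_rfl, by linarith⟩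
    ⟨by linarith, by linarith [min_le_right t (x + 1)]⟩).1 heq
  linarith

/-- The lift is not constant on any interval around a lift of a point of the Cantor set, since
constancy would put that point in the interior of a fibre. Where the lift increases there are
regular points. -/
theorem denjoySet_eq_closure (h : IsDenjoyBlowUp α a b f p) (hα : Irrational α) :
    denjoySet (blownInterval p α a) (blownInterval p α b) =
      closure (regularPoints p α a b) := by
  apply Subset.antisymm
  · obtain ⟨F, hF, hp⟩ := h.exists_lift
    intro x hx
    obtain ⟨x, -, rfl⟩ := exists_coe_mem_Ico 0 x
    rw [mem_closure_iff_nhds]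
    intro U hU
    have h1 : ∀ᶠ y : ℝ in 𝓝 x, (y : UnitAddCircle) ∈ U := continuous_coe_circle.continuousAt hU
    obtain ⟨l, u, hxlu, hlu⟩ := mem_nhds_iff_exists_Ioo_subset.1 h1
    rcases (F.monotone (hxlu.1.trans hxlu.2).le).eq_or_lt with heq | hlt
    · obtain ⟨n, hn⟩ := h.exists_mem_interior_of_lift_eq hp hxlu heq
      exact absurd (mem_iUnion.2 ⟨n, hn⟩) hx
    · obtain ⟨z, hz, hzr⟩ := exists_regularPoint_mem_Ioo (a := a) (b := b) hα hF hp hlt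
      exact ⟨z, hlu hz, hzr⟩
  · exact closure_minimal regularPoints_subset_denjoySet (isClosed_denjoySet _ _)

theorem denjoySet_subset (h : IsDenjoyBlowUp α a b f p) (hα : Irrational α)
    {N : Set UnitAddCircle} (hne : N.Nonempty) (hcl : IsClosed N) (hN : ∀ x ∈ N, f x ∈ N) :
    denjoySet (blownInterval p α a) (blownInterval p α b) ⊆ N := by
  rw [h.denjoySet_eq_closure hα]
  exact closure_minimal (h.regularPoints_subset hα hne hcl hN) hcl

theorem image_denjoySet (h : IsDenjoyBlowUp α a b f p) :
    f '' denjoySet (blownInterval p α a) (blownInterval p α b) =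
      denjoySet (blownInterval p α a) (blownInterval p α b) := by
  simp only [denjoySet]
  rw [image_compl_eq f.bijective, image_iUnion]
  congr 1
  simp only [image_union, f.image_interior, h.image_blownInterval]
  exact (Equiv.addRight (1 : ℤ)).surjective.iUnion_comp
    fun n => interior (blownInterval p α a n) ∪ interior (blownInterval p α b n)

theorem regularPoints_nonempty (h : IsDenjoyBlowUp α a b f p) :
    (regularPoints p α a b).Nonempty := by
  obtain ⟨y, hy⟩ := exists_forall_ne_add_zsmul α a b
  obtain ⟨x, rfl⟩ := h.surjective y
  exact ⟨x, hy⟩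

theorem accPt_regularPoints (h : IsDenjoyBlowUp α a b f p) (hα : Irrational α)
    {x : UnitAddCircle} (hx : x ∈ denjoySet (blownInterval p α a) (blownInterval p α b)) :
    AccPt x (𝓟 (regularPoints p α a b)) := by
  rw [accPt_iff_nhds]
  intro U hU
  by_cases hreg : x ∈ regularPoints p α a b
  · have hsub := h.denjoySet_subset hα (N := closure (range fun n : ℕ => f^[n + 1] x))
      ((range_nonempty _).closure) isClosed_closure (by
        intro y hy
        refine map_mem_closure f.continuous hy ?_
        rintro _ ⟨n, rfl⟩
        exact ⟨n + 1, Function.iterate_succ_apply' _ _ _⟩)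
    obtain ⟨_, hyU, n, rfl⟩ := mem_closure_iff_nhds.1 (hsub hx) U hU
    exact ⟨_, ⟨hyU, h.iterate_mem_regularPoints hreg _⟩, h.iterate_ne hα n x⟩
  · rw [h.denjoySet_eq_closure hα] at hx
    obtain ⟨y, hyU, hy⟩ := mem_closure_iff_nhds.1 hx U hU
    exact ⟨y, ⟨hyU, hy⟩, by rintro rfl; exact hreg hy⟩

/-- Two points of a connected set that avoids the interiors of the intervals of the first family
lie in the same fibre, and the set meets the interior of an interval of the second family. -/
theorem map_eq_of_isPreconnected (h : IsDenjoyBlowUp α a b f p) (hα : Irrational α)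
    {C : Set UnitAddCircle} (hC : IsPreconnected C)
    (hd : ∀ n, Disjoint C (interior (blownInterval p α a n))) {x y : UnitAddCircle}
    (hx : x ∈ C) (hy : y ∈ C) (hxy : x ≠ y) :
    p x = p y ∧ ∃ n, (C ∩ interior (blownInterval p α b n)).Nonempty := by
  obtain ⟨F, hF, hp⟩ := h.exists_lift
  obtain ⟨s, t, hst, hsub, hs, ht, hne⟩ := hC.exists_arc_subset hx hy hxy
  -- If `F` grew along the arc, the arc would meet the interior of an interval of the first family.
  have hFst : F s = F t := by
    refine (F.monotone hst.le).eq_or_lt.resolve_right fun hlt => ?_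
    obtain ⟨z, hz, n, hn⟩ := h.exists_interior_mem_Ioo hα hF hp hlt
    exact disjoint_left.1 (hd n) (hsub ⟨z, Ioo_subset_Icc_self hz, rfl⟩) hn
  have hpst : p (s : UnitAddCircle) = p (t : UnitAddCircle) := by rw [hp, hp, hFst]
  constructor
  · simp only [mem_insert_iff, mem_singleton_iff] at hs ht
    rcases hs with hs | hs <;> rcases ht with ht | ht <;> simp_all
  · have hm : (s + t) / 2 ∈ Ioo s t := ⟨by linarith, by linarith⟩
    obtain ⟨n, hn⟩ := h.exists_mem_interior_of_lift_eq hp hm hFst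
    have hmC := hsub ⟨_, Ioo_subset_Icc_self hm, rfl⟩
    rcases hn with hn | hn
    · exact absurd hn (disjoint_left.1 (hd n) hmC)
    · exact ⟨n, _, hmC, hn⟩

theorem isCantorSet_denjoySet (h : IsDenjoyBlowUp α a b f p) (hα : Irrational α) :
    IsCantorSet (denjoySet (blownInterval p α a) (blownInterval p α b)) := by
  have hcl := isClosed_denjoySet (blownInterval p α a) (blownInterval p α b)
  refine ⟨h.regularPoints_nonempty.mono regularPoints_subset_denjoySet, hcl.isCompact,
    ⟨hcl, fun x hx => (h.accPt_regularPoints hα hx).mono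
      (principal_mono.2 regularPoints_subset_denjoySet)⟩, ?_⟩
  intro C hCK hC x hx y hy
  by_contra hxy
  obtain ⟨-, n, z, hzC, hz⟩ := h.map_eq_of_isPreconnected hα hC
    (fun n => disjoint_left.2 fun z hzC hz => hCK hzC (mem_iUnion.2 ⟨n, Or.inl hz⟩)) hx hy hxy
  exact hCK hzC (mem_iUnion.2 ⟨n, Or.inr hz⟩)

theorem isMinimalSet_denjoySet (h : IsDenjoyBlowUp α a b f p) (hα : Irrational α) :
    IsMinimalSet {f} (denjoySet (blownInterval p α a) (blownInterval p α b)) := by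
  refine ⟨⟨(h.isCantorSet_denjoySet hα).1, isClosed_denjoySet _ _, ?_⟩, ?_⟩
  · rintro _ rfl
    exact h.image_denjoySet.subset
  · rintro N ⟨hne, hcl, hN⟩ -
    exact h.denjoySet_subset hα hne hcl fun x hx => hN f rfl ⟨x, hx, rfl⟩

theorem disjoint_blownInterval (hα : Irrational α) (c : UnitAddCircle) {m n : ℤ} (hmn : m ≠ n) :
    Disjoint (blownInterval p α c m) (blownInterval p α c n) := by
  refine Disjoint.preimage _ (disjoint_singleton.2 fun heq => hmn ?_)
  exact zsmul_coe_injective hα (add_left_cancel heq)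

theorem disjoint_blownInterval_of_ne (hab : ∀ n : ℤ, b ≠ a + n • (α : UnitAddCircle)) (m n : ℤ) :
    Disjoint (blownInterval p α a m) (blownInterval p α b n) := by
  refine Disjoint.preimage _ (disjoint_singleton.2 fun heq => hab (m - n) ?_)
  rw [sub_zsmul, eq_sub_of_add_eq heq.symm]
  abel

/-- The Cantor set together with the intervals of the first family is the complement of the
interiors of the intervals of the second family. -/
theorem denjoySet_union (hab : ∀ n : ℤ, b ≠ a + n • (α : UnitAddCircle)) :
    denjoySet (blownInterval p α a) (blownInterval p α b) ∪ ⋃ n, blownInterval p α a n =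
      (⋃ n, interior (blownInterval p α b n))ᶜ := by
  ext x
  constructor
  · rintro (hx | hx) hmem
    · obtain ⟨n, hn⟩ := mem_iUnion.1 hmem
      exact hx (mem_iUnion.2 ⟨n, Or.inr hn⟩)
    · obtain ⟨n, hn⟩ := mem_iUnion.1 hmem
      obtain ⟨m, hm⟩ := mem_iUnion.1 hx
      exact disjoint_left.1 (disjoint_blownInterval_of_ne hab m n) hm (interior_subset hn)
  · intro hx
    by_cases hK : x ∈ denjoySet (blownInterval p α a) (blownInterval p α b)
    · exact Or.inl hK
    · obtain ⟨n, hn | hn⟩ := mem_iUnion.1 (not_notMem.1 hK)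
      · exact Or.inr (mem_iUnion.2 ⟨n, interior_subset hn⟩)
      · exact absurd (mem_iUnion.2 ⟨n, hn⟩) hx

theorem interior_blownInterval_nonempty (h : IsDenjoyBlowUp α a b f p) (n : ℤ) :
    (interior (blownInterval p α a n)).Nonempty := by
  obtain ⟨s, t, hst, hts, heq⟩ := h.exists_blownInterval_eq_arc n
  rw [heq, interior_arc hts]
  exact (nonempty_Ioo.2 hst).image _

theorem blownInterval_subset_closure_interior (h : IsDenjoyBlowUp α a b f p) (n : ℤ) :
    blownInterval p α a n ⊆ closure (interior (blownInterval p α a n)) := by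
  obtain ⟨s, t, hst, hts, heq⟩ := h.exists_blownInterval_eq_arc n
  rw [heq]
  exact arc_subset_closure_interior hst hts

theorem isPreconnected_blownInterval (h : IsDenjoyBlowUp α a b f p) (n : ℤ) :
    IsPreconnected (blownInterval p α a n) := by
  obtain ⟨s, t, hst, hts, heq⟩ := h.exists_blownInterval_eq_arc n
  rw [heq]
  exact isPreconnected_arc s t

theorem isPreconnected_interior_blownInterval (h : IsDenjoyBlowUp α a b f p) (n : ℤ) :
    IsPreconnected (interior (blownInterval p α a n)) := by
  obtain ⟨s, t, hst, hts, heq⟩ := h.exists_blownInterval_eq_arc n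
  rw [heq, interior_arc hts]
  exact isPreconnected_Ioo.image _ continuous_coe_circle.continuousOn

theorem isCantorval_union (h : IsDenjoyBlowUp α a b f p) (hα : Irrational α)
    (hab : ∀ n : ℤ, b ≠ a + n • (α : UnitAddCircle)) :
    IsCantorval (denjoySet (blownInterval p α a) (blownInterval p α b) ∪
      ⋃ n, blownInterval p α a n) := by
  have hC := denjoySet_union (p := p) hab
  have hcl : IsClosed (denjoySet (blownInterval p α a) (blownInterval p α b) ∪
      ⋃ n, blownInterval p α a n) := by
    rw [hC]
    exact (isOpen_iUnion fun _ => isOpen_interior).isClosed_compl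
  set C := denjoySet (blownInterval p α a) (blownInterval p α b) ∪ ⋃ n, blownInterval p α a n
  have hdisj : ∀ n, Disjoint C (interior (blownInterval p α b n)) := fun n => by
    rw [hC]
    exact disjoint_compl_left_iff_subset.2 (subset_iUnion_of_subset n subset_rfl)
  have hIC : ∀ n, blownInterval p α a n ⊆ C := fun n =>
    (subset_iUnion_of_subset n subset_rfl).trans subset_union_right
  refine ⟨h.regularPoints_nonempty.mono
    (regularPoints_subset_denjoySet.trans subset_union_left), ?_, hcl.isCompact, ?_, ?_⟩
  · intro hu
    obtain ⟨x, hx⟩ := h.symm.interior_blownInterval_nonempty 0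
    exact disjoint_left.1 (hdisj 0) (hu ▸ mem_univ x) hx
  · apply Subset.antisymm
    · exact closure_minimal interior_subset hcl
    · have hint : ∀ n, interior (blownInterval p α a n) ⊆ interior C := fun n =>
        interior_mono (hIC n)
      apply union_subset
      -- The closure of the union of these interiors is nonempty, closed and `f`-invariant, so
      -- minimality places the Cantor set inside it.
      · refine (h.denjoySet_subset hα (N := closure (⋃ n, interior (blownInterval p α a n)))
          ?_ isClosed_closure ?_).trans (closure_mono (iUnion_subset hint))
        · obtain ⟨x, hx⟩ := h.interior_blownInterval_nonempty 0
          exact ⟨x, subset_closure (mem_iUnion.2 ⟨0, hx⟩)⟩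
        · intro x hx
          refine map_mem_closure f.continuous hx ?_
          intro y hy
          obtain ⟨n, hn⟩ := mem_iUnion.1 hy
          refine mem_iUnion.2 ⟨n + 1, ?_⟩
          rw [← h.image_blownInterval, ← f.image_interior]
          exact ⟨y, hn, rfl⟩
      · exact iUnion_subset fun n =>
          (h.blownInterval_subset_closure_interior n).trans (closure_mono (hint n))
  · intro x hx _ y hy
    have hyC : y ∈ C := closure_minimal (connectedComponentIn_subset C x) hcl hy.1
    -- If `y` were in the interior of an interval of the first family, the component would contain
    -- that interval and `y` would not be on its frontier.
    have hyK : y ∈ denjoySet (blownInterval p α a) (blownInterval p α b) := by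
      intro hmem
      obtain ⟨n, hn | hn⟩ := mem_iUnion.1 hmem
      · obtain ⟨z, hz, hzx⟩ := mem_closure_iff_nhds.1 hy.1 _ (isOpen_interior.mem_nhds hn)
        have hsub : blownInterval p α a n ⊆ connectedComponentIn C x := by
          rw [connectedComponentIn_eq hzx]
          exact (h.isPreconnected_blownInterval n).subset_connectedComponentIn
            (interior_subset hz) (hIC n)
        exact hy.2 (interior_mono hsub hn)
      · exact disjoint_left.1 (hdisj n) hyC hn
    -- The accumulating points are the regular ones: a component of `C` avoids the gaps of the
    -- second family, so it lies in one fibre, which for a regular point is a singleton.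
    refine (h.accPt_regularPoints hα hyK).mono (principal_mono.2 fun z hz => ?_)
    have hzC : z ∈ C := Or.inl (regularPoints_subset_denjoySet hz)
    refine ⟨hzC, Subset.antisymm (fun w hw => ?_)
      (singleton_subset_iff.2 (mem_connectedComponentIn hzC))⟩
    by_contra hwz
    have hpz := (h.symm.map_eq_of_isPreconnected hα isPreconnected_connectedComponentIn
      (fun n => (hdisj n).mono_left (connectedComponentIn_subset C z))
      hw (mem_connectedComponentIn hzC) hwz).1
    exact hwz (h.fibre_subsingleton _ hz hpz rfl)

end IsDenjoyBlowUp

/-! ### Flows whose field is supported on two intervals. -/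

theorem eq_univ_of_add_one_mem_of_sub_sqrt_two_mem {T : Set ℝ} (hT : IsClosed T) (h0 : 0 ∈ T)
    (h1 : ∀ t ∈ T, 1 + t ∈ T) (h2 : ∀ t ∈ T, -√2 + t ∈ T) : T = univ := by
  have hn : ∀ n : ℕ, -(n * √2) ∈ T := by
    intro n
    induction n with
    | zero => simpa using h0
    | succ n ih => convert h2 _ ih using 1; push_cast; ring
  have hmn : ∀ m n : ℕ, (m - n * √2 : ℝ) ∈ T := by
    intro m n
    induction m with
    | zero => simpa using hn n
    | succ m ih => convert h1 _ ih using 1; push_cast; ring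
  refine eq_univ_of_forall fun t => ?_
  rw [← hT.closure_eq, Metric.mem_closure_iff]
  intro ε hε
  obtain ⟨m, n, hlt⟩ := exists_nat_sub_mul_sqrt_two t hε
  exact ⟨_, hmn m n, by rwa [dist_comm, Real.dist_eq]⟩

namespace IsFlowOf

variable {v : UnitAddCircle → ℝ} {φ : Flow ℝ UnitAddCircle}

/-- Continuity of `v` makes the lifted trajectory strictly differentiable at time `0`, and its
nonzero derivative makes it open there. No uniqueness of solutions is needed. -/
theorem orbit_mem_nhds (h : IsFlowOf v φ) (hv : Continuous v) {x : UnitAddCircle}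
    (hx : v x ≠ 0) : range (fun t => φ t x) ∈ 𝓝 x := by
  obtain ⟨γ, hγ, hd⟩ := h x
  have hγ0 : (γ 0 : UnitAddCircle) = x := by rw [hγ, φ.map_zero_apply]
  have hcont : Continuous γ := continuous_iff_continuousAt.2 fun t => (hd t).continuousAt
  have hs : HasStrictDerivAt γ (v (γ 0 : UnitAddCircle)) 0 :=
    hasStrictDerivAt_of_hasDerivAt_of_continuousAt (f' := fun t => v (γ t : UnitAddCircle))
      (Eventually.of_forall hd)
      (hv.comp (continuous_coe_circle.comp hcont)).continuousAt
  have hmap := hs.map_nhds_eq (by rwa [hγ0])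
  have hr : range γ ∈ 𝓝 (γ 0) := hmap ▸ range_mem_map
  have hr' := isOpenMap_coe_circle.image_mem_nhds hr
  rw [hγ0, ← range_comp] at hr'
  convert hr' using 1
  ext y
  simp [hγ]

/-- The times at which the trajectory is at `x` form a clopen set. Vanishing on a neighbourhood
matters: the flow of a merely continuous field may pass through an isolated zero. -/
theorem apply_eq_self (h : IsFlowOf v φ) {W : Set UnitAddCircle} (hW : IsOpen W)
    (hv : ∀ y ∈ W, v y = 0) {x : UnitAddCircle} (hx : x ∈ W) (t : ℝ) : φ t x = x := by
  have hφ : Continuous fun t : ℝ => φ t x := φ.continuous continuous_id continuous_const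
  have hclopen : IsClopen {t : ℝ | φ t x = x} := by
    refine ⟨isClosed_eq hφ continuous_const, isOpen_iff_mem_nhds.2 fun s hs => ?_⟩
    obtain ⟨γ, hγ, hd⟩ := h x
    have hs : φ s x = x := hs
    have hmem : ∀ᶠ r in 𝓝 s, φ r x ∈ W :=
      hφ.continuousAt (hW.mem_nhds (by rw [hs]; exact hx))
    obtain ⟨ε, hε, hball⟩ := Metric.eventually_nhds_iff_ball.1 hmem
    have hconst : ∀ r ∈ Metric.ball s ε, γ r = γ s := by
      intro r hr
      refine (convex_ball s ε).is_const_of_fderivWithin_eq_zero (𝕜 := ℝ) (f := γ)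
        (fun u _ => (hd u).differentiableAt.differentiableWithinAt) (fun u hu => ?_) hr
        (Metric.mem_ball_self hε)
      have h1 := hd u
      rw [hγ, hv _ (hball u hu)] at h1
      rw [fderivWithin_eq_fderiv (Metric.isOpen_ball.uniqueDiffWithinAt hu) h1.differentiableAt,
        h1.hasFDerivAt.fderiv]
      ext
      simp
    filter_upwards [Metric.ball_mem_nhds s hε] with r hr
    rw [← hγ, hconst r hr, hγ, hs]
  have huniv := hclopen.eq_univ ⟨0, φ.map_zero_apply x⟩
  exact eq_univ_iff_forall.1 huniv t

section TwoIntervals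

variable {A B : Set UnitAddCircle}

theorem apply_eq_self_of_notMem (h : IsFlowOf v φ) (hA : IsClosed A) (hB : IsClosed B)
    (hv : ∀ x, v x ≠ 0 ↔ x ∈ interior A ∪ interior B) {x : UnitAddCircle} (hxA : x ∉ A)
    (hxB : x ∉ B) (t : ℝ) : φ t x = x := by
  refine h.apply_eq_self (hA.union hB).isOpen_compl (fun y hy => ?_)
    (show x ∈ (A ∪ B)ᶜ from fun hx => hx.elim hxA hxB) t
  by_contra hne
  exact hy (((hv y).1 hne).imp (fun h => interior_subset h) fun h => interior_subset h)

/-- Points off `A ∪ B` are fixed, so a trajectory starting in `A` cannot reach them. It stays in `A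
∪ B` and, being connected, in `A`. -/
theorem apply_mem (h : IsFlowOf v φ) (hA : IsClosed A) (hB : IsClosed B) (hAB : Disjoint A B)
    (hv : ∀ x, v x ≠ 0 ↔ x ∈ interior A ∪ interior B) {x : UnitAddCircle} (hx : x ∈ A)
    (t : ℝ) : φ t x ∈ A := by
  have hφ : Continuous fun t : ℝ => φ t x := φ.continuous continuous_id continuous_const
  have hun : ∀ s, φ s x ∈ A ∪ B := by
    intro s
    by_contra hs
    have h1 := h.apply_eq_self_of_notMem hA hB hv (fun hm => hs (Or.inl hm))
      (fun hm => hs (Or.inr hm)) (-s)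
    rw [← φ.map_add, neg_add_cancel, φ.map_zero_apply] at h1
    exact hs (Or.inl (h1 ▸ hx))
  by_contra hc
  have hc' := (hun t).resolve_left hc
  obtain ⟨y, -, hyA, hyB⟩ := isPreconnected_closed_iff.1 (isPreconnected_range hφ) A B hA hB
    (by rintro _ ⟨s, rfl⟩; exact hun s) ⟨x, ⟨0, φ.map_zero_apply x⟩, hx⟩ ⟨_, ⟨t, rfl⟩, hc'⟩
  exact disjoint_left.1 hAB hyA hyB

theorem image_interior (h : IsFlowOf v φ) (hA : IsClosed A) (hB : IsClosed B)
    (hAB : Disjoint A B) (hv : ∀ x, v x ≠ 0 ↔ x ∈ interior A ∪ interior B) (t : ℝ) :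
    φ t '' interior A = interior A := by
  have h1 : φ t '' A = A := (φ.isInvariant_iff_image_eq A).1
    (fun s x hx => h.apply_mem hA hB hAB hv hx s) t
  have h2 := (φ.toHomeomorph t).image_interior A
  rwa [show (φ.toHomeomorph t : UnitAddCircle → UnitAddCircle) '' A = A from h1] at h2

/-- Inside `interior A` every flow-invariant set is open. An orbit and its complement are both
invariant, so connectedness leaves a single orbit. -/
theorem exists_apply_eq (h : IsFlowOf v φ) (hvc : Continuous v)
    (hv : ∀ x, v x ≠ 0 ↔ x ∈ interior A ∪ interior B) (hpre : IsPreconnected (interior A))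
    {x y : UnitAddCircle} (hx : x ∈ interior A) (hy : y ∈ interior A) : ∃ t, φ t x = y := by
  by_contra hne
  have hopen : ∀ S : Set UnitAddCircle, (∀ z ∈ S, ∀ t, φ t z ∈ S) → S ∩ interior A ⊆ interior S :=
    fun S hS z hz => mem_interior_iff_mem_nhds.2 <| mem_of_superset
      (h.orbit_mem_nhds hvc ((hv z).2 (Or.inl hz.2))) (by rintro _ ⟨t, rfl⟩; exact hS z hz.1 t)
  have hO : ∀ z ∈ range (fun t => φ t x), ∀ t, φ t z ∈ range (fun t => φ t x) := by
    rintro _ ⟨s, rfl⟩ t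
    exact ⟨t + s, φ.map_add _ _ _⟩
  have hOc : ∀ z ∈ (range (fun t => φ t x))ᶜ, ∀ t, φ t z ∈ (range (fun t => φ t x))ᶜ := by
    rintro z hz t ⟨s, hs⟩
    refine hz ⟨-t + s, ?_⟩
    dsimp only at hs ⊢
    rw [φ.map_add, hs, ← φ.map_add, neg_add_cancel, φ.map_zero_apply]
  obtain ⟨z, -, hz1, hz2⟩ := hpre _ _ isOpen_interior isOpen_interior
    (fun z hz => (em (z ∈ range fun t => φ t x)).imp (fun hm => hopen _ hO ⟨hm, hz⟩)
      fun hm => hopen _ hOc ⟨hm, hz⟩)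
    ⟨x, hx, hopen _ hO ⟨⟨0, φ.map_zero_apply x⟩, hx⟩⟩
    ⟨y, hy, hopen _ hOc ⟨hne, hy⟩⟩
  exact interior_subset hz2 (interior_subset hz1)

/-- A closed set invariant under the time `σ` and time `-σ√2` maps, `σ = ±1`, which meets the
interior of `A` contains it. -/
theorem interior_subset_of_invariant (h : IsFlowOf v φ) (hvc : Continuous v)
    (hv : ∀ x, v x ≠ 0 ↔ x ∈ interior A ∪ interior B) (hpre : IsPreconnected (interior A))
    {σ : ℝ} (hσ : σ * σ = 1) {N : Set UnitAddCircle} (hN : IsClosed N)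
    (h1 : ∀ x ∈ N, φ (σ * 1) x ∈ N) (h2 : ∀ x ∈ N, φ (σ * -√2) x ∈ N)
    (hne : (N ∩ interior A).Nonempty) : interior A ⊆ N := by
  obtain ⟨x, hxN, hxA⟩ := hne
  intro y hy
  obtain ⟨t, rfl⟩ := h.exists_apply_eq hvc hv hpre hxA hy
  -- The sign `σ` treats the flow maps and their inverses together; the time `s = σ * t` then gives
  -- `φ t x ∈ N`, because `σ * σ = 1`.
  have hT : {s : ℝ | φ (σ * s) x ∈ N} = univ := by
    refine eq_univ_of_add_one_mem_of_sub_sqrt_two_mem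
      (hN.preimage (φ.continuous (continuous_const.mul continuous_id) continuous_const))
      (by simpa [φ.map_zero_apply] using hxN) (fun s hs => ?_) (fun s hs => ?_)
    · rw [mem_ofPred_eq, mul_add, φ.map_add]
      exact h1 _ hs
    · rw [mem_ofPred_eq, mul_add, φ.map_add]
      exact h2 _ hs
  have := (hT ▸ mem_univ (σ * t) : σ * t ∈ {s : ℝ | φ (σ * s) x ∈ N})
  rwa [mem_ofPred_eq, ← mul_assoc, hσ, one_mul] at this

end TwoIntervals

end IsFlowOf

/-! ### Invariant sets of the semigroup. -/

theorem Int.forall_of_iff_add_one {P : ℤ → Prop} (hP : ∀ n, P n ↔ P (n + 1)) {k : ℤ} (hk : P k)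
    (n : ℤ) : P n := by
  have key : ∀ m : ℤ, P (k + m) := fun m => by
    induction m using Int.induction_on with
    | zero => rwa [add_zero]
    | succ m ih => rw [← add_assoc]; exact (hP _).1 ih
    | pred m ih => exact (hP _).2 (by rwa [add_assoc, sub_add_cancel])
  simpa using key (n - k)

theorem denjoySet_comm (I J : ℤ → Set UnitAddCircle) : denjoySet I J = denjoySet J I := by
  simp only [denjoySet, union_comm]

/-- Existence and uniqueness of the minimal set both reduce to finding a least element among the
nonempty closed invariant sets. -/
theorem isMinimalSet_iff_eq {X : Type*} [TopologicalSpace X] {A : Set (X ≃ₜ X)} {C M : Set X}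
    (hne : C.Nonempty) (hcl : IsClosed C) (hinv : ∀ h ∈ A, h '' C ⊆ C)
    (hmin : ∀ N : Set X, N.Nonempty → IsClosed N → (∀ h ∈ A, h '' N ⊆ N) → C ⊆ N) :
    IsMinimalSet A M ↔ M = C := by
  constructor
  · intro hM
    exact (hM.eq_of_subset ⟨hne, hcl, hinv⟩ (hmin M hM.prop.1 hM.prop.2.1 hM.prop.2.2)).symm
  · rintro rfl
    exact ⟨⟨hne, hcl, hinv⟩, fun N hN _ => hmin N hN.1 hN.2.1 hN.2.2⟩

theorem closure_orbit_invariant {X : Type*} [TopologicalSpace X] (G : Subsemigroup (X ≃ₜ X))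
    (x : X) {h : X ≃ₜ X} (hh : h ∈ G) :
    h '' closure {y | ∃ e ∈ G, y = e x} ⊆ closure {y | ∃ e ∈ G, y = e x} := by
  rintro _ ⟨y, hy, rfl⟩
  refine map_mem_closure h.continuous hy ?_
  rintro _ ⟨e, he, rfl⟩
  exact ⟨h * e, G.mul_mem hh he, rfl⟩

theorem closure_backward_orbit_invariant {X : Type*} [TopologicalSpace X]
    (G : Subsemigroup (X ≃ₜ X)) (x : X) {h : X ≃ₜ X} (hh : h⁻¹ ∈ G) :
    h '' closure {y | ∃ e ∈ G, x = e y} ⊆ closure {y | ∃ e ∈ G, x = e y} := by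
  rintro _ ⟨y, hy, rfl⟩
  refine map_mem_closure h.continuous hy ?_
  rintro y ⟨e, he, rfl⟩
  exact ⟨e * h⁻¹, G.mul_mem he hh, by
    rw [Homeomorph.mul_apply]; exact congrArg e (h.symm_apply_apply y).symm⟩

namespace IsDenjoyBlowUp

variable {α : ℝ} {a b : UnitAddCircle} {f : UnitAddCircle ≃ₜ UnitAddCircle}
  {p : UnitAddCircle → UnitAddCircle}

theorem isClosed_blownInterval (h : IsDenjoyBlowUp α a b f p) (c : UnitAddCircle) (n : ℤ) :
    IsClosed (blownInterval p α c n) :=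
  h.isClosed_fibre _

theorem map_mem_interior_iff (h : IsDenjoyBlowUp α a b f p) (c : UnitAddCircle) (n : ℤ)
    (x : UnitAddCircle) :
    x ∈ interior (blownInterval p α c n) ↔ f x ∈ interior (blownInterval p α c (n + 1)) := by
  rw [← h.image_blownInterval, ← f.image_interior, f.injective.mem_set_image]

theorem image_iUnion_interior (h : IsDenjoyBlowUp α a b f p) (c : UnitAddCircle) :
    f '' (⋃ n, interior (blownInterval p α c n)) = ⋃ n, interior (blownInterval p α c n) := by
  rw [image_iUnion]
  simp only [f.image_interior, h.image_blownInterval]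
  exact (Equiv.addRight (1 : ℤ)).surjective.iUnion_comp
    fun n => interior (blownInterval p α c n)

theorem symm_image_iUnion_interior (h : IsDenjoyBlowUp α a b f p) (c : UnitAddCircle) :
    f.symm '' (⋃ n, interior (blownInterval p α c n)) =
      ⋃ n, interior (blownInterval p α c n) := by
  nth_rw 1 [← h.image_iUnion_interior c]
  exact f.toEquiv.symm_image_image _

variable {v : UnitAddCircle → ℝ} {φ : Flow ℝ UnitAddCircle}

theorem flow_image_iUnion_interior (h : IsDenjoyBlowUp α a b f p) (hα : Irrational α)
    (hab : ∀ n : ℤ, b ≠ a + n • (α : UnitAddCircle)) (hφ : IsFlowOf v φ)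
    (hv : ∀ x, v x ≠ 0 ↔ x ∈ interior (blownInterval p α a 0) ∪ interior (blownInterval p α b 0))
    (t : ℝ) :
    φ t '' (⋃ n, interior (blownInterval p α a n)) = ⋃ n, interior (blownInterval p α a n) := by
  rw [image_iUnion]
  congr 1
  ext1 n
  by_cases hn : n = 0
  · subst hn
    exact hφ.image_interior (h.isClosed_blownInterval a 0) (h.isClosed_blownInterval b 0)
      (disjoint_blownInterval_of_ne hab 0 0) hv t
  · have hfix : ∀ x ∈ interior (blownInterval p α a n), φ t x = x := fun x hx =>
      hφ.apply_eq_self_of_notMem (h.isClosed_blownInterval a 0) (h.isClosed_blownInterval b 0) hv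
        (disjoint_left.1 (disjoint_blownInterval hα a hn) (interior_subset hx))
        (disjoint_left.1 (disjoint_blownInterval_of_ne hab n 0) (interior_subset hx)) t
    rw [image_congr hfix, image_id']

/-- A closed set invariant under `f`, `f⁻¹` and the flow maps which meets the interior of one of
the intervals of the first family contains the Cantorval that this family defines. -/
theorem union_subset_of_invariant (h : IsDenjoyBlowUp α a b f p) (hα : Irrational α)
    (hφ : IsFlowOf v φ) (hvc : Continuous v)
    (hv : ∀ x, v x ≠ 0 ↔ x ∈ interior (blownInterval p α a 0) ∪ interior (blownInterval p α b 0))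
    {σ : ℝ} (hσ : σ * σ = 1) {N : Set UnitAddCircle} (hcl : IsClosed N)
    (hf : ∀ x ∈ N, f x ∈ N) (hf' : ∀ x ∈ N, f.symm x ∈ N)
    (h1 : ∀ x ∈ N, φ (σ * 1) x ∈ N) (h2 : ∀ x ∈ N, φ (σ * -√2) x ∈ N) {k : ℤ}
    (hne : (N ∩ interior (blownInterval p α a k)).Nonempty) :
    denjoySet (blownInterval p α a) (blownInterval p α b) ∪ ⋃ n, blownInterval p α a n ⊆ N := by
  have hmeet : (N ∩ interior (blownInterval p α a 0)).Nonempty := by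
    refine Int.forall_of_iff_add_one
      (P := fun n => (N ∩ interior (blownInterval p α a n)).Nonempty) (fun n => ⟨?_, ?_⟩) hne 0
    · rintro ⟨x, hxN, hx⟩
      exact ⟨f x, hf x hxN, (h.map_mem_interior_iff a n x).1 hx⟩
    · rintro ⟨x, hxN, hx⟩
      refine ⟨f.symm x, hf' x hxN, (h.map_mem_interior_iff a n _).2 ?_⟩
      rwa [f.apply_symm_apply]
  have h0 : interior (blownInterval p α a 0) ⊆ N :=
    hφ.interior_subset_of_invariant hvc hv (h.isPreconnected_interior_blownInterval 0) hσ hcl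
      h1 h2 hmeet
  have hall : ∀ n, interior (blownInterval p α a n) ⊆ N := by
    refine Int.forall_of_iff_add_one (fun n => ⟨fun hn x hx => ?_, fun hn x hx => ?_⟩) h0
    · have := hf _ (hn ((h.map_mem_interior_iff a n (f.symm x)).2 (by rwa [f.apply_symm_apply])))
      rwa [f.apply_symm_apply] at this
    · have := hf' _ (hn ((h.map_mem_interior_iff a n x).1 hx))
      rwa [f.symm_apply_apply] at this
  exact union_subset (h.denjoySet_subset hα (hmeet.mono inter_subset_left) hcl hf)
    (iUnion_subset fun n => (h.blownInterval_subset_closure_interior n).trans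
      (closure_minimal (hall n) hcl))

end IsDenjoyBlowUp

/-! ### The push map and the two Cantorvals. -/

section PushMap

variable {I J : ℤ → Set UnitAddCircle} {i' k i'' : ℤ} {p₁ p₂ q₁ q₂ p₁' p₂' : ℝ}
  {g : UnitAddCircle ≃ₜ UnitAddCircle}

/-- A point moved by the push map lies in the interior of one of the two outer intervals or
strictly between the outer intervals. -/
theorem IsPushMap.cases_of_ne (ht : IsCyclicTriple I J i' k i'' p₁ p₂ q₁ q₂ p₁' p₂')
    (hg : IsPushMap (J k) p₁ p₂ p₁' p₂' g) {x : UnitAddCircle} (hx : g x ≠ x) :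
    x ∈ interior (I i') ∨ x ∈ interior (I i'') ∨ x ∈ arc p₂ p₁' := by
  obtain ⟨t, htm, rfl⟩ := not_imp_comm.1 (hg.eq_id x) hx
  dsimp only at hx ⊢
  have h1 : t ≠ p₁ := by rintro rfl; exact hx hg.fix_left
  have h2 : t ≠ p₂' := by rintro rfl; exact hx hg.fix_right
  rcases lt_or_ge t p₂ with h3 | h3
  · left
    rw [ht.first, interior_arc (by linarith [ht.lt₂, ht.lt₃, ht.lt₄, ht.lt₅, ht.lt₆])]
    exact ⟨t, ⟨lt_of_le_of_ne htm.1 h1.symm, h3⟩, rfl⟩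
  · rcases le_or_gt t p₁' with h4 | h4
    · exact Or.inr (Or.inr ⟨t, ⟨h3, h4⟩, rfl⟩)
    · right; left
      rw [ht.last, interior_arc (by linarith [ht.lt₁, ht.lt₂, ht.lt₃, ht.lt₄, ht.lt₆])]
      exact ⟨t, ⟨h4, lt_of_le_of_ne htm.2 h2⟩, rfl⟩

theorem IsPushMap.map_mem_interior (hg : IsPushMap (J k) p₁ p₂ p₁' p₂' g) {t : ℝ}
    (ht : t ∈ Ioo p₂ p₁') : g (t : UnitAddCircle) ∈ interior (J k) := by
  refine interior_maximal ((image_mono (image_mono Ioo_subset_Icc_self)).trans hg.maps_into)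
    (g.isOpenMap _ (isOpenMap_coe_circle _ (isOpen_Ioo (a := p₂) (b := p₁')))) ?_
  exact ⟨_, ⟨t, ht, rfl⟩, rfl⟩

/-- For the blown intervals the set is `C₂`. Its moved points avoid the interiors of the outer
intervals, so they lie between these and go into `J k`, which is disjoint from every `I n`. -/
theorem IsPushMap.image_compl_subset (ht : IsCyclicTriple I J i' k i'' p₁ p₂ q₁ q₂ p₁' p₂')
    (hg : IsPushMap (J k) p₁ p₂ p₁' p₂' g) (hIJ : ∀ m n, Disjoint (I m) (J n)) :
    g '' (⋃ n, interior (I n))ᶜ ⊆ (⋃ n, interior (I n))ᶜ := by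
  rintro _ ⟨x, hx, rfl⟩ hgx
  by_cases hfix : g x = x
  · exact hx (hfix ▸ hgx)
  · rcases hg.cases_of_ne ht hfix with h1 | h1 | h1
    · exact hx (mem_iUnion.2 ⟨_, h1⟩)
    · exact hx (mem_iUnion.2 ⟨_, h1⟩)
    · obtain ⟨n, hn⟩ := mem_iUnion.1 hgx
      exact disjoint_left.1 (hIJ n k) (interior_subset hn) (hg.maps_into ⟨x, h1, rfl⟩)

/-- For the blown intervals the set is `C₁`. On complements the claim is that `g` sends gaps into
gaps: a moved point of `interior (J n)` lies in no `I m`, hence strictly between `p₂` and `p₁'`, and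
lands in `interior (J k)`. -/
theorem IsPushMap.subset_image_compl (ht : IsCyclicTriple I J i' k i'' p₁ p₂ q₁ q₂ p₁' p₂')
    (hg : IsPushMap (J k) p₁ p₂ p₁' p₂' g) (hIJ : ∀ m n, Disjoint (I m) (J n)) :
    (⋃ n, interior (J n))ᶜ ⊆ g '' (⋃ n, interior (J n))ᶜ := by
  rw [image_compl_eq g.bijective, compl_subset_compl]
  rintro _ ⟨x, hx, rfl⟩
  by_cases hfix : g x = x
  · rwa [hfix]
  · obtain ⟨n, hn⟩ := mem_iUnion.1 hx
    have hxI : ∀ m, x ∉ I m := fun m hm => disjoint_left.1 (hIJ m n) hm (interior_subset hn)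
    rcases hg.cases_of_ne ht hfix with h1 | h1 | ⟨t, htm, rfl⟩
    · exact absurd (interior_subset h1) (hxI _)
    · exact absurd (interior_subset h1) (hxI _)
    · refine mem_iUnion.2 ⟨k, hg.map_mem_interior ⟨lt_of_le_of_ne htm.1 ?_,
        lt_of_le_of_ne htm.2 ?_⟩⟩
      · rintro rfl
        exact hxI i' (ht.first ▸ ⟨_, right_mem_Icc.2 ht.lt₁.le, rfl⟩)
      · rintro rfl
        exact hxI i'' (ht.last ▸ ⟨_, left_mem_Icc.2 ht.lt₅.le, rfl⟩)

end PushMap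

/-! ### Forward and backward minimality. -/

section Minimality

variable {α : ℝ} {a b : UnitAddCircle} {f : UnitAddCircle ≃ₜ UnitAddCircle}
  {p : UnitAddCircle → UnitAddCircle} {i' k i'' : ℤ} {p₁ p₂ q₁ q₂ p₁' p₂' : ℝ}
  {g : UnitAddCircle ≃ₜ UnitAddCircle} {v : UnitAddCircle → ℝ} {φ : Flow ℝ UnitAddCircle}

theorem IsCyclicTriple.lift_lt
    (hab : ∀ n : ℤ, b ≠ a + n • (α : UnitAddCircle))
    (ht : IsCyclicTriple (blownInterval p α a) (blownInterval p α b) i' k i'' p₁ p₂ q₁ q₂ p₁' p₂')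
    {F : CircleDeg1Lift} (hp : ∀ t : ℝ, p (t : UnitAddCircle) = (F t : ℝ)) : F p₂ < F q₁ := by
  refine (F.monotone ht.lt₂.le).lt_of_ne fun heq => ?_
  have h2 : (p₂ : UnitAddCircle) ∈ blownInterval p α a i' :=
    ht.first ▸ ⟨_, right_mem_Icc.2 ht.lt₁.le, rfl⟩
  have h3 : (q₁ : UnitAddCircle) ∈ blownInterval p α b k :=
    ht.middle ▸ ⟨_, left_mem_Icc.2 ht.lt₃.le, rfl⟩
  refine disjoint_left.1 (IsDenjoyBlowUp.disjoint_blownInterval_of_ne hab i' k) h2 ?_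
  have : p (p₂ : UnitAddCircle) = p (q₁ : UnitAddCircle) := by rw [hp, hp, heq]
  rw [blownInterval, mem_preimage] at h3 ⊢
  rwa [this]

/-- Every invariant closed set contains this point, and `g` or `g⁻¹` carries it into a blown
interval, which starts the filling argument. -/
theorem IsDenjoyBlowUp.exists_regularPoint_mem_gap (h : IsDenjoyBlowUp α a b f p)
    (hα : Irrational α) (hab : ∀ n : ℤ, b ≠ a + n • (α : UnitAddCircle))
    (ht : IsCyclicTriple (blownInterval p α a) (blownInterval p α b) i' k i''
      p₁ p₂ q₁ q₂ p₁' p₂') :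
    ∃ t ∈ Ioo p₂ p₁', (t : UnitAddCircle) ∈ regularPoints p α a b := by
  obtain ⟨F, hF, hp⟩ := h.exists_lift
  obtain ⟨t, htm, hreg⟩ := IsDenjoyBlowUp.exists_regularPoint_mem_Ioo (a := a) (b := b) hα hF hp
    (ht.lift_lt hab hp)
  exact ⟨t, ⟨htm.1, by linarith [htm.2, ht.lt₃, ht.lt₄]⟩, hreg⟩

theorem IsDenjoyBlowUp.subset_of_forward_invariant (h : IsDenjoyBlowUp α a b f p)
    (hα : Irrational α) (hab : ∀ n : ℤ, b ≠ a + n • (α : UnitAddCircle))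
    (hφ : IsFlowOf v φ) (hvc : Continuous v)
    (hv : ∀ x, v x ≠ 0 ↔ x ∈ interior (blownInterval p α a 0) ∪ interior (blownInterval p α b 0))
    (ht : IsCyclicTriple (blownInterval p α a) (blownInterval p α b) i' k i'' p₁ p₂ q₁ q₂ p₁' p₂')
    (hg : IsPushMap (blownInterval p α b k) p₁ p₂ p₁' p₂' g)
    {N : Set UnitAddCircle} (hne : N.Nonempty) (hcl : IsClosed N)
    (hN : ∀ e ∈ exampleSemigroup f (φ.toHomeomorph 1) (φ.toHomeomorph (-√2)) g, e '' N ⊆ N) :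
    denjoySet (blownInterval p α a) (blownInterval p α b) ∪ ⋃ n, blownInterval p α b n ⊆ N := by
  have hgen : ∀ e ∈ ({f, f⁻¹, φ.toHomeomorph 1, φ.toHomeomorph (-√2), g} :
      Set (UnitAddCircle ≃ₜ UnitAddCircle)), ∀ x ∈ N, e x ∈ N := fun e he x hx =>
    hN e (Subsemigroup.subset_closure he) ⟨x, hx, rfl⟩
  have hf : ∀ x ∈ N, f x ∈ N := hgen f (by simp)
  obtain ⟨t, htm, hreg⟩ := h.exists_regularPoint_mem_gap hα hab ht
  have htN := h.regularPoints_subset hα hne hcl hf hreg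
  rw [denjoySet_comm]
  -- The families are exchanged so that the `J n` are filled; the starting point is the image under
  -- `g` of the regular point in the gap.
  refine h.symm.union_subset_of_invariant hα hφ hvc (by simpa only [union_comm] using hv)
    (one_mul 1) hcl hf (hgen f⁻¹ (by simp)) ?_ ?_
    ⟨g t, hgen g (by simp) _ htN, hg.map_mem_interior htm⟩
  · rw [one_mul]
    exact hgen (φ.toHomeomorph 1) (by simp)
  · rw [one_mul]
    exact hgen (φ.toHomeomorph (-√2)) (by simp)

theorem IsDenjoyBlowUp.subset_of_backward_invariant (h : IsDenjoyBlowUp α a b f p)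
    (hα : Irrational α) (hab : ∀ n : ℤ, b ≠ a + n • (α : UnitAddCircle))
    (hφ : IsFlowOf v φ) (hvc : Continuous v)
    (hv : ∀ x, v x ≠ 0 ↔ x ∈ interior (blownInterval p α a 0) ∪ interior (blownInterval p α b 0))
    (ht : IsCyclicTriple (blownInterval p α a) (blownInterval p α b) i' k i'' p₁ p₂ q₁ q₂ p₁' p₂')
    (hg : IsPushMap (blownInterval p α b k) p₁ p₂ p₁' p₂' g)
    {N : Set UnitAddCircle} (hne : N.Nonempty) (hcl : IsClosed N)
    (hN : ∀ e, e⁻¹ ∈ exampleSemigroup f (φ.toHomeomorph 1) (φ.toHomeomorph (-√2)) g →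
      e '' N ⊆ N) :
    denjoySet (blownInterval p α a) (blownInterval p α b) ∪ ⋃ n, blownInterval p α a n ⊆ N := by
  have hgen : ∀ e ∈ ({f, f⁻¹, φ.toHomeomorph 1, φ.toHomeomorph (-√2), g} :
      Set (UnitAddCircle ≃ₜ UnitAddCircle)), ∀ x ∈ N, e.symm x ∈ N := fun e he x hx =>
    hN e⁻¹ (by rw [inv_inv]; exact Subsemigroup.subset_closure he) ⟨x, hx, rfl⟩
  have hf : ∀ x ∈ N, f x ∈ N := hgen f⁻¹ (by simp)
  obtain ⟨t, htm, hreg⟩ := h.exists_regularPoint_mem_gap hα hab ht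
  have htN := h.regularPoints_subset hα hne hcl hf hreg
  have hmeet : ∃ n, (N ∩ interior (blownInterval p α a n)).Nonempty := by
    -- Since `g` sends `arc p₂ p₁'` into `J k` and the regular point is not in `J k`, its preimage
    -- is off that arc. It is therefore a moved point, and only the interiors of the outer intervals
    -- remain for it.
    have hnot : g.symm (t : UnitAddCircle) ∉ arc p₂ p₁' := fun hmem =>
      (hreg k).2 (hg.maps_into ⟨_, hmem, g.apply_symm_apply _⟩)
    have hmoved : g (g.symm (t : UnitAddCircle)) ≠ g.symm (t : UnitAddCircle) := by
      rw [g.apply_symm_apply]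
      intro heq
      exact hnot (heq ▸ ⟨t, Ioo_subset_Icc_self htm, rfl⟩)
    have hgN := hgen g (by simp) _ htN
    rcases hg.cases_of_ne ht hmoved with h1 | h1 | h1
    · exact ⟨_, _, hgN, h1⟩
    · exact ⟨_, _, hgN, h1⟩
    · exact absurd h1 hnot
  obtain ⟨n, hn⟩ := hmeet
  refine h.union_subset_of_invariant hα hφ hvc hv (σ := -1) (by norm_num) hcl hf
    (hgen f (by simp)) ?_ ?_ hn
  · rw [mul_one]
    exact hgen (φ.toHomeomorph 1) (by simp)
  · rw [neg_one_mul]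
    exact hgen (φ.toHomeomorph (-√2)) (by simp)

theorem IsDenjoyBlowUp.forward_invariant (h : IsDenjoyBlowUp α a b f p)
    (hα : Irrational α) (hab : ∀ n : ℤ, b ≠ a + n • (α : UnitAddCircle)) (hφ : IsFlowOf v φ)
    (hv : ∀ x, v x ≠ 0 ↔ x ∈ interior (blownInterval p α a 0) ∪ interior (blownInterval p α b 0))
    (ht : IsCyclicTriple (blownInterval p α a) (blownInterval p α b) i' k i'' p₁ p₂ q₁ q₂ p₁' p₂')
    (hg : IsPushMap (blownInterval p α b k) p₁ p₂ p₁' p₂' g)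
    {e : UnitAddCircle ≃ₜ UnitAddCircle}
    (he : e ∈ exampleSemigroup f (φ.toHomeomorph 1) (φ.toHomeomorph (-√2)) g) :
    e '' (⋃ n, interior (blownInterval p α a n))ᶜ ⊆ (⋃ n, interior (blownInterval p α a n))ᶜ := by
  induction he using Subsemigroup.closure_induction with
  | mem e he =>
    rcases he with rfl | rfl | rfl | rfl | rfl
    · rw [image_compl_eq e.bijective, h.image_iUnion_interior]
    · rw [image_compl_eq f⁻¹.bijective]
      exact (congrArg _ (h.symm_image_iUnion_interior a)).subset
    · rw [image_compl_eq (φ.toHomeomorph 1).bijective]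
      exact (congrArg _ (h.flow_image_iUnion_interior hα hab hφ hv 1)).subset
    · rw [image_compl_eq (φ.toHomeomorph (-√2)).bijective]
      exact (congrArg _ (h.flow_image_iUnion_interior hα hab hφ hv (-√2))).subset
    · exact hg.image_compl_subset ht (IsDenjoyBlowUp.disjoint_blownInterval_of_ne hab)
  | mul x y _ _ hx hy =>
    rintro _ ⟨z, hz, rfl⟩
    exact hx ⟨_, hy ⟨z, hz, rfl⟩, rfl⟩

theorem IsDenjoyBlowUp.backward_invariant (h : IsDenjoyBlowUp α a b f p)
    (hα : Irrational α) (hab : ∀ n : ℤ, b ≠ a + n • (α : UnitAddCircle)) (hφ : IsFlowOf v φ)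
    (hv : ∀ x, v x ≠ 0 ↔ x ∈ interior (blownInterval p α a 0) ∪ interior (blownInterval p α b 0))
    (ht : IsCyclicTriple (blownInterval p α a) (blownInterval p α b) i' k i'' p₁ p₂ q₁ q₂ p₁' p₂')
    (hg : IsPushMap (blownInterval p α b k) p₁ p₂ p₁' p₂' g)
    {e : UnitAddCircle ≃ₜ UnitAddCircle}
    (he : e ∈ exampleSemigroup f (φ.toHomeomorph 1) (φ.toHomeomorph (-√2)) g) :
    (⋃ n, interior (blownInterval p α b n))ᶜ ⊆ e '' (⋃ n, interior (blownInterval p α b n))ᶜ := by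
  have hab' : ∀ n : ℤ, a ≠ b + n • (α : UnitAddCircle) := fun n hn =>
    hab (-n) (by rw [hn, neg_zsmul]; abel)
  have hv' : ∀ x, v x ≠ 0 ↔
      x ∈ interior (blownInterval p α b 0) ∪ interior (blownInterval p α a 0) := by
    simpa only [union_comm] using hv
  induction he using Subsemigroup.closure_induction with
  | mem e he =>
    rcases he with rfl | rfl | rfl | rfl | rfl
    · rw [image_compl_eq e.bijective, h.image_iUnion_interior]
    · rw [image_compl_eq f⁻¹.bijective]
      exact (congrArg _ (h.symm_image_iUnion_interior b)).superset
    · rw [image_compl_eq (φ.toHomeomorph 1).bijective]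
      exact (congrArg _ (h.symm.flow_image_iUnion_interior hα hab' hφ hv' 1)).superset
    · rw [image_compl_eq (φ.toHomeomorph (-√2)).bijective]
      exact (congrArg _ (h.symm.flow_image_iUnion_interior hα hab' hφ hv' (-√2))).superset
    · exact hg.subset_image_compl ht (IsDenjoyBlowUp.disjoint_blownInterval_of_ne hab)
  | mul x y _ _ hx hy =>
    intro z hz
    obtain ⟨w, hw, rfl⟩ := hx hz
    obtain ⟨u, hu, rfl⟩ := hy hw
    exact ⟨u, hu, rfl⟩

end Minimality

/-! ### Existence of the vector field and its flow. -/

open scoped NNReal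

/-- A bounded field allows Picard–Lindelöf on every `[-n, n]` with radius `L * n`, the distance
covered at speed `L`. Uniqueness glues the local solutions. -/
theorem exists_global_solution {u : ℝ → ℝ} {K L : ℝ≥0} (hK : LipschitzWith K u)
    (hL : ∀ x, ‖u x‖ ≤ L) (x₀ : ℝ) : ∃ γ : ℝ → ℝ, γ 0 = x₀ ∧ ∀ t, HasDerivAt γ (u (γ t)) t := by
  have hloc : ∀ n : ℕ, ∃ γ : ℝ → ℝ, γ 0 = x₀ ∧
      ∀ t ∈ Ioo (-(n : ℝ)) n, HasDerivAt γ (u (γ t)) t := by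
    intro n
    have h0 : (0 : ℝ) ∈ Icc (-(n : ℝ)) n := by simp
    have hPL : IsPicardLindelof (fun _ => u) (⟨0, h0⟩ : Icc (-(n : ℝ)) n) x₀ (L * n) 0 L K :=
      .of_time_independent (fun x _ => hL x) hK.lipschitzOnWith (by simp)
    obtain ⟨γ, hγ0, hγ⟩ := hPL.exists_eq_forall_mem_Icc_hasDerivWithinAt₀
    exact ⟨γ, hγ0, fun t ht => (hγ t (Ioo_subset_Icc_self ht)).hasDerivAt (Icc_mem_nhds ht.1 ht.2)⟩
  choose Γ hΓ0 hΓ using hloc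
  have huniq : ∀ m n : ℕ, 0 < m → m ≤ n → EqOn (Γ m) (Γ n) (Ioo (-(m : ℝ)) m) := by
    intro m n hm hmn
    have hmn' : (m : ℝ) ≤ n := by exact_mod_cast hmn
    have hm' : (0 : ℝ) < m := by exact_mod_cast hm
    exact ODE_solution_unique_of_mem_Ioo (v := fun _ => u) (s := fun _ => univ) (t₀ := 0)
      (fun _ _ => hK.lipschitzOnWith) ⟨by linarith, hm'⟩ (fun t ht => ⟨hΓ m t ht, mem_univ _⟩)
      (fun t ht => ⟨hΓ n t ⟨by linarith [ht.1], by linarith [ht.2]⟩, mem_univ _⟩)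
      (by rw [hΓ0, hΓ0])
  have hnat : ∀ t : ℝ, t ∈ Ioo (-((⌊|t|⌋₊ + 1 : ℕ) : ℝ)) ((⌊|t|⌋₊ + 1 : ℕ) : ℝ) := fun t => by
    have := Nat.lt_floor_add_one |t|
    push_cast
    exact abs_lt.1 this
  have heq : ∀ n : ℕ, ∀ t ∈ Ioo (-(n : ℝ)) n, Γ (⌊|t|⌋₊ + 1) t = Γ n t := by
    intro n t ht
    have hn : 0 < n := by
      have : (0 : ℝ) < n := by linarith [ht.1, ht.2]
      exact_mod_cast this
    rcases le_total (⌊|t|⌋₊ + 1) n with h | h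
    · exact huniq _ _ (Nat.succ_pos _) h (hnat t)
    · exact (huniq _ _ hn h ht).symm
  refine ⟨fun t => Γ (⌊|t|⌋₊ + 1) t, hΓ0 _, fun t => ?_⟩
  refine (hΓ _ t (hnat t)).congr_of_eventuallyEq ?_
  filter_upwards [Ioo_mem_nhds (hnat t).1 (hnat t).2] with s hs using heq _ s hs

theorem exists_flow_of_lipschitzWith {v : UnitAddCircle → ℝ} {K : ℝ≥0} (hv : LipschitzWith K v) :
    ∃ φ : Flow ℝ UnitAddCircle, IsFlowOf v φ := by
  have hu : LipschitzWith K (fun x : ℝ => v x) := by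
    refine LipschitzWith.of_dist_le_mul fun x y => (hv.dist_le_mul x y).trans ?_
    gcongr
    rw [dist_eq_norm, dist_eq_norm, ← AddCircle.coe_sub]
    exact QuotientAddGroup.norm_mk_le_norm
  obtain ⟨L, hL⟩ : ∃ L : ℝ≥0, ∀ x : UnitAddCircle, ‖v x‖ ≤ L := by
    obtain ⟨C, hC⟩ := isCompact_univ.exists_bound_of_continuousOn hv.continuous.continuousOn
    exact ⟨C.toNNReal, fun x => (hC x (mem_univ x)).trans (Real.le_coe_toNNReal C)⟩
  choose Φ hΦ0 hΦ using exists_global_solution hu (fun x => hL x)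
  have huniq : ∀ γ δ : ℝ → ℝ, (∀ t, HasDerivAt γ (v (γ t)) t) → (∀ t, HasDerivAt δ (v (δ t)) t) →
      γ 0 = δ 0 → γ = δ := fun γ δ hγ hδ h0 =>
    ODE_solution_unique_univ (v := fun _ x => v (x : UnitAddCircle)) (s := fun _ => univ)
      (fun _ => hu.lipschitzOnWith) (fun t => ⟨hγ t, mem_univ _⟩) (fun t => ⟨hδ t, mem_univ _⟩) h0
  have hadd : ∀ s t x, Φ x (s + t) = Φ (Φ x t) s := fun s t x =>
    congrFun (huniq (fun r => Φ x (r + t)) (Φ (Φ x t)) (fun r => (hΦ x (r + t)).comp_add_const r t)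
      (hΦ _) (by simp [hΦ0])) s
  have hper : ∀ (x : ℝ) (m : ℤ) t, Φ (x + m) t = Φ x t + m := fun x m t =>
    congrFun (huniq (Φ (x + m)) (fun r => Φ x r + m) (hΦ _) (fun r => by
      simpa only [coe_add_int] using (hΦ x r).add_const (m : ℝ)) (by simp [hΦ0])) t
  have hcont : Continuous (fun q : ℝ × ℝ => Φ q.2 q.1) := by
    have hlip : ∀ x, LipschitzWith L (Φ x) := fun x =>
      lipschitzWith_of_nnnorm_deriv_le (fun t => (hΦ x t).differentiableAt) fun t => by
        rw [(hΦ x t).deriv]; exact hL _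
    have hinv : ∀ x t, Φ (Φ x t) (-t) = x := fun x t => by
      rw [← hadd, neg_add_cancel, hΦ0]
    refine continuous_prod_of_continuous_lipschitzWith _ L (fun t => ?_) hlip
    -- Trajectories that changed order would meet and hence coincide. Monotonicity and surjectivity
    -- then give continuity in the initial point.
    have hmono : Monotone fun x => Φ x t := by
      refine StrictMono.monotone fun x y hxy => ?_
      have hc : Continuous fun s => Φ y s - Φ x s :=
        (hlip y).continuous.sub (hlip x).continuous
      by_contra! hle
      obtain ⟨s, hs⟩ := mem_range_of_exists_le_of_exists_ge hc
        (c := 0) ⟨t, by simpa using hle⟩ ⟨0, by simpa [hΦ0] using hxy.le⟩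
      have := congrArg (fun z => Φ z (-s)) (sub_eq_zero.1 hs)
      simp only [hinv] at this
      exact hxy.ne' this
    refine hmono.continuous_of_surjective fun z => ⟨Φ z (-t), ?_⟩
    have := hinv z (-t)
    rwa [neg_neg] at this
  have hperiodic : ∀ t, Function.Periodic (fun x : ℝ => (Φ x t : UnitAddCircle)) 1 := fun t x => by
    have := hper x 1 t
    rw [Int.cast_one] at this
    simp only [this, coe_add_one]
  have hmk : ∀ x : UnitAddCircle, ∃ r : ℝ, (r : UnitAddCircle) = x := fun x =>
    (exists_coe_mem_Ico 0 x).imp fun _ h => h.2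
  have hq : IsOpenQuotientMap (Prod.map (id : ℝ → ℝ) fun x : ℝ => (x : UnitAddCircle)) :=
    IsOpenQuotientMap.id.prodMap ⟨hmk, continuous_coe_circle, isOpenMap_coe_circle⟩
  let φ : Flow ℝ UnitAddCircle :=
    { toFun := fun t => (hperiodic t).lift
      cont' := by
        rw [hq.isQuotientMap.continuous_iff]
        exact continuous_coe_circle.comp hcont
      map_add' := by
        intro s t x
        obtain ⟨r, rfl⟩ := hmk x
        simp only [Function.Periodic.lift_coe, hadd]
      map_zero' := by
        intro x
        obtain ⟨r, rfl⟩ := hmk x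
        simp only [Function.Periodic.lift_coe, hΦ0] }
  refine ⟨φ, fun x => ?_⟩
  obtain ⟨r, rfl⟩ := hmk x
  exact ⟨Φ r, fun t => rfl, hΦ r⟩

/-- The distance to the complement of `U` serves as the field. -/
theorem exists_lipschitz_field {U : Set UnitAddCircle} (hU : IsOpen U) (hne : U ≠ univ) :
    ∃ (v : UnitAddCircle → ℝ) (φ : Flow ℝ UnitAddCircle), (∃ L, LipschitzWith L v) ∧
      (∀ x, v x ≠ 0 ↔ x ∈ U) ∧ IsFlowOf v φ := by
  obtain ⟨φ, hφ⟩ := exists_flow_of_lipschitzWith (Metric.lipschitz_infDist_pt Uᶜ)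
  refine ⟨_, φ, ⟨_, Metric.lipschitz_infDist_pt Uᶜ⟩, fun x => ?_, hφ⟩
  rw [not_iff_comm, ← mem_compl_iff,
    hU.isClosed_compl.mem_iff_infDist_zero (nonempty_compl.2 hne)]

/-! ### Existence of the three intervals and of the push map. -/

theorem IsDenjoyBlowUp.exists_cyclicTriple {α : ℝ} {a b : UnitAddCircle}
    {f : UnitAddCircle ≃ₜ UnitAddCircle} {p : UnitAddCircle → UnitAddCircle}
    (h : IsDenjoyBlowUp α a b f p) (hα : Irrational α)
    (hab : ∀ n : ℤ, b ≠ a + n • (α : UnitAddCircle)) :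
    ∃ (i' k i'' : ℤ) (p₁ p₂ q₁ q₂ p₁' p₂' : ℝ),
      IsCyclicTriple (blownInterval p α a) (blownInterval p α b) i' k i''
        p₁ p₂ q₁ q₂ p₁' p₂' := by
  obtain ⟨F, hF, hp⟩ := h.exists_lift
  obtain ⟨A, -, hA⟩ := exists_coe_mem_Ico 0 (a + (0 : ℤ) • (α : UnitAddCircle))
  obtain ⟨B, hB, hB'⟩ := exists_coe_mem_Ico A (b + (0 : ℤ) • (α : UnitAddCircle))
  have hAB : A < B := lt_of_le_of_ne hB.1 fun heq => hab 0 (by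
    have := hA.symm.trans ((congrArg _ heq).trans hB')
    simpa using this.symm)
  have hd : Dense ((fun x : ℝ => (x : UnitAddCircle)) ⁻¹'
      range (fun n : ℕ => a + n • (α : UnitAddCircle))) :=
    (denseRange_add_nsmul hα a).preimage isOpenMap_coe_circle
  -- With lifts `A < B < A + 1` of `a` and `b`, density of the orbit of `a` puts some `a + n • α`
  -- between `B` and `A + 1`. The fibres inherit this order.
  obtain ⟨C, ⟨n, hC⟩, hBC, hCA⟩ := hd.exists_between hB.2
  have hC' : (C : UnitAddCircle) = a + (n : ℤ) • (α : UnitAddCircle) := by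
    rw [natCast_zsmul]; exact hC.symm
  have hnA := (h.fibre_nontrivial 0).1
  have hnB := (h.fibre_nontrivial 0).2
  have hnC := (h.fibre_nontrivial n).1
  rw [← hA] at hnA
  rw [← hB'] at hnB
  rw [← hC'] at hnC
  obtain ⟨p₁, p₂, hp12, -, hpI, hpa⟩ := exists_fibre_eq_Icc hF hp hnA
  obtain ⟨q₁, q₂, hq12, -, hqI, hqa⟩ := exists_fibre_eq_Icc hF hp hnB
  obtain ⟨p₁', p₂', hp12', -, hpI', hpa'⟩ := exists_fibre_eq_Icc hF hp hnC
  have e1 : F p₁ = A := (hpI ▸ left_mem_Icc.2 hp12.le : p₁ ∈ F ⁻¹' {A})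
  have e2 : F p₂ = A := (hpI ▸ right_mem_Icc.2 hp12.le : p₂ ∈ F ⁻¹' {A})
  have e3 : F q₁ = B := (hqI ▸ left_mem_Icc.2 hq12.le : q₁ ∈ F ⁻¹' {B})
  have e4 : F q₂ = B := (hqI ▸ right_mem_Icc.2 hq12.le : q₂ ∈ F ⁻¹' {B})
  have e5 : F p₁' = C := (hpI' ▸ left_mem_Icc.2 hp12'.le : p₁' ∈ F ⁻¹' {C})
  have e6 : F p₂' = C := (hpI' ▸ right_mem_Icc.2 hp12'.le : p₂' ∈ F ⁻¹' {C})
  have e7 : F (p₁ + 1) = A + 1 := by rw [F.map_add_one, e1]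
  refine ⟨0, 0, n, p₁, p₂, q₁, q₂, p₁', p₂', hp12, ?_, hq12, ?_, hp12', ?_, ?_, ?_, ?_⟩
  · exact F.monotone.reflect_lt (by rwa [e2, e3])
  · exact F.monotone.reflect_lt (by rwa [e4, e5])
  · exact F.monotone.reflect_lt (by rwa [e6, e7])
  · rw [blownInterval, ← hA, hpa]
  · rw [blownInterval, ← hB', hqa]
  · rw [blownInterval, ← hC', hpa']

/-- An increasing homeomorphism of the line which moves `x` to `y` and is the identity outside
`(l, r)`. -/
theorem exists_orderIso_apply_eq {l r x y : ℝ} (hx : x ∈ Ioo l r) (hy : y ∈ Ioo l r) :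
    ∃ e : ℝ ≃o ℝ, e x = y ∧ ∀ z, z ∉ Ioo l r → e z = z := by
  wlog hxy : x ≤ y generalizing x y
  · obtain ⟨e, he, he'⟩ := this hy hx (le_of_not_ge hxy)
    exact ⟨e.symm, e.symm_apply_eq.2 he.symm, fun z hz => e.symm_apply_eq.2 (he' z hz).symm⟩
  have hxl : 0 < x - l := sub_pos.2 hx.1
  have hrx : 0 < r - x := sub_pos.2 hx.2
  have hA : 1 ≤ (y - l) / (x - l) := (one_le_div hxl).2 (by linarith)
  have hB : 0 < (r - y) / (r - x) := div_pos (sub_pos.2 hy.2) hrx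
  have hB' : (r - y) / (r - x) ≤ 1 := (div_le_one hrx).2 (by linarith)
  have hAx : (y - l) / (x - l) * (x - l) = y - l := div_mul_cancel₀ _ hxl.ne'
  have hBx : (r - y) / (r - x) * (r - x) = r - y := div_mul_cancel₀ _ hrx.ne'
  set A := (y - l) / (x - l)
  set B := (r - y) / (r - x)
  let T : ℝ → ℝ := fun z => max z (min (l + A * (z - l)) (r - B * (r - z)))
  have hT : StrictMono T := fun z w hzw => max_lt_max hzw (min_lt_min (by nlinarith) (by nlinarith))
  have hfix : ∀ z, z ∉ Ioo l r → T z = z := by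
    intro z hz
    refine max_eq_left ?_
    rcases le_or_gt z l with h | h
    · exact (min_le_left _ _).trans (by nlinarith)
    · have h2 : r ≤ z := not_lt.1 fun h2 => hz ⟨h, h2⟩
      exact (min_le_right _ _).trans (by nlinarith)
  have hsurj : Function.Surjective T := by
    refine Continuous.surjective (by fun_prop)
      (tendsto_atTop_mono (fun z => le_max_left _ _) tendsto_id) ?_
    refine tendsto_id.congr' ?_
    filter_upwards [eventually_le_atBot l] with z hz
    exact (hfix z fun h => h.1.not_ge hz).symm
  refine ⟨hT.orderIsoOfSurjective T hsurj, ?_, hfix⟩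
  change max x (min (l + A * (x - l)) (r - B * (r - x))) = y
  rw [hAx, hBx, add_sub_cancel, sub_sub_cancel, min_self, max_eq_right hxy]

/-- An increasing homeomorphism of the line fixing `c` and `c + 1` descends to the circle. -/
theorem exists_homeomorph_of_orderIso {c : ℝ} (e : ℝ ≃o ℝ) (h0 : e c = c)
    (h1 : e (c + 1) = c + 1) : ∃ g : UnitAddCircle ≃ₜ UnitAddCircle,
      ∀ t ∈ Icc c (c + 1), g (t : UnitAddCircle) = (e t : UnitAddCircle) := by
  have hIco : ∀ e : ℝ ≃o ℝ, e c = c → e (c + 1) = c + 1 → ∀ t ∈ Ico c (c + 1),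
      e t ∈ Ico c (c + 1) := fun e h0 h1 t ht =>
    ⟨h0 ▸ e.monotone ht.1, h1 ▸ e.strictMono ht.2⟩
  let lift : (ℝ ≃o ℝ) → UnitAddCircle → UnitAddCircle := fun e =>
    AddCircle.liftIco 1 c fun t => (e t : UnitAddCircle)
  have happly : ∀ e : ℝ ≃o ℝ, ∀ t ∈ Ico c (c + 1), lift e (t : UnitAddCircle) = (e t : ℝ) :=
    fun e t ht => AddCircle.liftIco_coe_apply ht
  have hcont : ∀ e : ℝ ≃o ℝ, e c = c → e (c + 1) = c + 1 → Continuous (lift e) :=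
    fun e h0 h1 => AddCircle.liftIco_continuous (by rw [h0, h1, coe_add_one])
      (continuous_coe_circle.comp e.continuous).continuousOn
  have hinv : ∀ e : ℝ ≃o ℝ, e c = c → e (c + 1) = c + 1 → ∀ x, lift e.symm (lift e x) = x := by
    intro e h0 h1 x
    obtain ⟨t, ht, rfl⟩ := exists_coe_mem_Ico c x
    rw [happly e t ht, happly _ _ (hIco e h0 h1 t ht), e.symm_apply_apply]
  have h0' : e.symm c = c := e.symm_apply_eq.2 h0.symm
  have h1' : e.symm (c + 1) = c + 1 := e.symm_apply_eq.2 h1.symm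
  refine ⟨⟨⟨lift e, lift e.symm, hinv e h0 h1, hinv e.symm h0' h1'⟩, hcont e h0 h1,
    hcont e.symm h0' h1'⟩, fun t ht => ?_⟩
  change lift e t = _
  rcases ht.2.eq_or_lt with rfl | hlt
  · rw [h1, coe_add_one, happly e c ⟨le_rfl, by linarith⟩, h0]
  · exact happly e t ⟨ht.1, hlt⟩

theorem IsCyclicTriple.exists_pushMap {I J : ℤ → Set UnitAddCircle} {i' k i'' : ℤ}
    {p₁ p₂ q₁ q₂ p₁' p₂' : ℝ} (ht : IsCyclicTriple I J i' k i'' p₁ p₂ q₁ q₂ p₁' p₂') :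
    ∃ g : UnitAddCircle ≃ₜ UnitAddCircle, IsPushMap (J k) p₁ p₂ p₁' p₂' g := by
  obtain ⟨l1, l2, l3, l4, l5, l6, -, hJ, -⟩ := ht
  -- First `p₂` moves to `q₁` with `p₁'` fixed, then `p₁'` moves to `q₂` with `q₁` fixed; the
  -- composite sends `[p₂, p₁']` onto `[q₁, q₂]`.
  obtain ⟨e₁, he₁, he₁'⟩ := exists_orderIso_apply_eq (l := p₁) (r := p₁') (x := p₂) (y := q₁)
    ⟨l1, by linarith⟩ ⟨by linarith, by linarith⟩
  obtain ⟨e₂, he₂, he₂'⟩ := exists_orderIso_apply_eq (l := q₁) (r := p₂') (x := p₁') (y := q₂)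
    ⟨by linarith, l5⟩ ⟨by linarith, by linarith⟩
  have hfix : ∀ z, z ∉ Ioo p₁ p₂' → (e₁.trans e₂) z = z := by
    intro z hz
    rw [OrderIso.trans_apply, he₁' z (fun h => hz ⟨h.1, h.2.trans l5⟩),
      he₂' z (fun h => hz ⟨by linarith [h.1], h.2⟩)]
  have hp₂ : (e₁.trans e₂) p₂ = q₁ := by
    rw [OrderIso.trans_apply, he₁, he₂' _ (fun h => lt_irrefl _ h.1)]
  have hp₁' : (e₁.trans e₂) p₁' = q₂ := by
    rw [OrderIso.trans_apply, he₁' _ (fun h => lt_irrefl _ h.2), he₂]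
  obtain ⟨g, hg⟩ := exists_homeomorph_of_orderIso (e₁.trans e₂) (hfix p₁ fun h => lt_irrefl _ h.1)
    (hfix (p₁ + 1) fun h => by linarith [h.2])
  refine ⟨g, ⟨?_, ?_, ?_, fun x hx => ?_⟩⟩
  · rw [hg _ ⟨le_rfl, by linarith⟩, hfix _ fun h => lt_irrefl _ h.1]
  · rw [hg _ ⟨by linarith, l6.le⟩, hfix _ fun h => lt_irrefl _ h.2]
  · rintro _ ⟨_, ⟨t, ht, rfl⟩, rfl⟩
    rw [hJ, hg _ ⟨by linarith [ht.1], by linarith [ht.2]⟩]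
    exact ⟨_, ⟨hp₂ ▸ (e₁.trans e₂).monotone ht.1, hp₁' ▸ (e₁.trans e₂).monotone ht.2⟩, rfl⟩
  · obtain ⟨t, ht, rfl⟩ := exists_coe_mem_Ico p₁ x
    rw [hg t ⟨ht.1, ht.2.le⟩, hfix t fun h => hx ⟨t, Ioo_subset_Icc_self h, rfl⟩]

/-! ### Denjoy's construction. -/

section Construction

open Function (leftLim rightLim)

theorem abs_ceil_sub_sub_ceil_neg_le (c y : ℝ) :
    |((⌈y - c⌉ : ℤ) : ℝ) - (⌈-c⌉ : ℤ)| ≤ |y| + 1 := by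
  have h1 := Int.le_ceil (y - c)
  have h2 := Int.ceil_lt_add_one (y - c)
  have h3 := Int.le_ceil (-c)
  have h4 := Int.ceil_lt_add_one (-c)
  have h5 := le_abs_self y
  have h6 := neg_abs_le y
  rw [abs_le]
  constructor <;> linarith

/-- A strictly increasing function commuting with the unit translation whose discontinuities are
exactly the translates of a given countable family of points. -/
theorem exists_strictMono_jumps {ι : Type*} [Encodable ι] (c : ι → ℝ) :
    ∃ H : ℝ → ℝ, StrictMono H ∧ (∀ y, H (y + 1) = H y + 1) ∧
      ∀ y, leftLim H y < rightLim H y ↔ ∃ i, ∃ m : ℤ, y = c i + m := by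
  obtain ⟨w, hw, W, hW, -⟩ := posSumOfEncodable one_pos ι
  have hW0 : 0 ≤ W := hW.nonneg fun i => (hw i).le
  have hW1 : 0 < 1 + W := by linarith
  -- For `y ≥ 0` the bracket counts the translates of `c i` in `[0, y)`. It grows by `1` over each
  -- period, so `y + S y` grows by `1 + W`, the normalizing factor of `H`.
  let s : ℝ → ι → ℝ := fun y i => w i * (((⌈y - c i⌉ : ℤ) : ℝ) - (⌈-c i⌉ : ℤ))
  have hbound : ∀ y i, ‖s y i‖ ≤ w i * (|y| + 1) := fun y i => by
    rw [norm_mul, Real.norm_eq_abs, Real.norm_eq_abs, abs_of_pos (hw i)]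
    exact mul_le_mul_of_nonneg_left (abs_ceil_sub_sub_ceil_neg_le _ _) (hw i).le
  have hsum : ∀ y, Summable (s y) := fun y =>
    Summable.of_norm_bounded (hW.summable.mul_right _) (hbound y)
  let S : ℝ → ℝ := fun y => ∑' i, s y i
  have hsmono : ∀ {x y}, x ≤ y → ∀ i, s x i ≤ s y i := fun {x y} hxy i => by
    have : (⌈x - c i⌉ : ℝ) ≤ ⌈y - c i⌉ := by exact_mod_cast Int.ceil_mono (by linarith)
    exact mul_le_mul_of_nonneg_left (by linarith) (hw i).le
  have hSmono : Monotone S := fun x y hxy => (hsum x).tsum_le_tsum (hsmono hxy) (hsum y)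
  let H : ℝ → ℝ := fun y => (y + S y) / (1 + W)
  have hH : StrictMono H := fun x y hxy =>
    div_lt_div_of_pos_right (add_lt_add_of_lt_of_le hxy (hSmono hxy.le)) hW1
  refine ⟨H, hH, fun y => ?_, fun y => ⟨fun hlt => ?_, ?_⟩⟩
  · have h1 : S (y + 1) = S y + W := by
      rw [← hW.tsum_eq, ← (hsum y).tsum_add hW.summable]
      refine tsum_congr fun i => ?_
      have : y + 1 - c i = y - c i + 1 := by ring
      simp only [s, this, Int.ceil_add_one]
      push_cast
      ring
    simp only [H, h1]
    field_simp
    ring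
  · by_contra! hne
    have hcont : ContinuousAt H y := by
      refine (continuousAt_id.add ?_).div_const _
      refine tendsto_tsum_of_dominated_convergence (hW.summable.mul_right (|y| + 2))
        (fun i => ?_) ?_
      · refine tendsto_const_nhds.mul (Tendsto.sub ?_ tendsto_const_nhds)
        have hlt1 : (⌈y - c i⌉ : ℝ) - 1 < y - c i := by linarith [Int.ceil_lt_add_one (y - c i)]
        have hlt2 : y - c i < ⌈y - c i⌉ := lt_of_le_of_ne (Int.le_ceil _) fun heq =>
          hne i ⌈y - c i⌉ (by linarith)
        refine tendsto_const_nhds.congr' ?_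
        filter_upwards [Ioo_mem_nhds (show (⌈y - c i⌉ : ℝ) - 1 + c i < y by linarith)
          (show y < (⌈y - c i⌉ : ℝ) + c i by linarith)] with x hx
        have : ⌈x - c i⌉ = ⌈y - c i⌉ := Int.ceil_eq_iff.2 ⟨by linarith [hx.1], by linarith [hx.2]⟩
        rw [this]
      · have : ∀ᶠ x in 𝓝 y, |x| < |y| + 1 :=
          continuous_abs.continuousAt.eventually_lt continuousAt_const (by linarith)
        filter_upwards [this] with x hx i
        exact (hbound x i).trans (mul_le_mul_of_nonneg_left (by linarith) (hw i).le)
    exact hlt.ne (hH.monotone.continuousAt_iff_leftLim_eq_rightLim.1 hcont)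
  · rintro ⟨i, m, rfl⟩
    have hjump : ∀ x < c i + m, ∀ x' > c i + m, H x + w i / (1 + W) ≤ H x' := by
      intro x hx x' hx'
      have h1 : w i ≤ s x' i - s x i := by
        have h2 : (⌈x - c i⌉ : ℝ) ≤ m := by exact_mod_cast Int.ceil_le.2 (by linarith)
        have h3 : (m + 1 : ℝ) ≤ ⌈x' - c i⌉ := by
          exact_mod_cast Int.lt_ceil.2 (by linarith)
        have := hw i
        simp only [s]
        nlinarith
      have h2 : s x' i - s x i ≤ S x' - S x := by
        rw [← (hsum x').tsum_sub (hsum x)]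
        exact ((hsum x').sub (hsum x)).le_tsum i fun j _ =>
          sub_nonneg.2 (hsmono (hx.trans hx').le j)
      simp only [H]
      rw [← add_div]
      exact div_le_div_of_nonneg_right (by linarith) hW1.le
    have hpos : 0 < w i / (1 + W) := div_pos (hw i) hW1
    have h3 : ∀ x < c i + m, H x + w i / (1 + W) ≤ rightLim H (c i + m) := fun x hx =>
      ge_of_tendsto (hH.monotone.tendsto_rightLim _) (by
        filter_upwards [self_mem_nhdsWithin] with x' hx' using hjump x hx x' hx')
    have h4 : leftLim H (c i + m) + w i / (1 + W) ≤ rightLim H (c i + m) :=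
      le_of_tendsto ((hH.monotone.tendsto_leftLim _).add_const _) (by
        filter_upwards [self_mem_nhdsWithin] with x hx using h3 x hx)
    linarith

section GeneralizedInverse

variable {H : ℝ → ℝ}

theorem leftLim_add_one (hH : Monotone H) (h1 : ∀ y, H (y + 1) = H y + 1) (y : ℝ) :
    leftLim H (y + 1) = leftLim H y + 1 := by
  have ht : Tendsto (fun x : ℝ => x + 1) (𝓝[<] y) (𝓝[<] (y + 1)) :=
    tendsto_nhdsWithin_of_tendsto_nhds_of_eventually_within _
      (((continuous_add_const 1).tendsto y).mono_left nhdsWithin_le_nhds)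
      (by filter_upwards [self_mem_nhdsWithin] with x hx using add_lt_add_left (mem_Iio.1 hx) 1)
  refine tendsto_nhds_unique ((hH.tendsto_leftLim (y + 1)).comp ht) ?_
  exact ((hH.tendsto_leftLim y).add_const 1).congr fun x => (h1 x).symm

theorem rightLim_add_one (hH : Monotone H) (h1 : ∀ y, H (y + 1) = H y + 1) (y : ℝ) :
    rightLim H (y + 1) = rightLim H y + 1 := by
  have ht : Tendsto (fun x : ℝ => x + 1) (𝓝[>] y) (𝓝[>] (y + 1)) :=
    tendsto_nhdsWithin_of_tendsto_nhds_of_eventually_within _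
      (((continuous_add_const 1).tendsto y).mono_left nhdsWithin_le_nhds)
      (by filter_upwards [self_mem_nhdsWithin] with x hx using add_lt_add_left (mem_Ioi.1 hx) 1)
  refine tendsto_nhds_unique ((hH.tendsto_rightLim (y + 1)).comp ht) ?_
  exact ((hH.tendsto_rightLim y).add_const 1).congr fun x => (h1 x).symm

theorem StrictMono.rightLim_lt_leftLim (hH : StrictMono H) {x y : ℝ} (hxy : x < y) :
    rightLim H x < leftLim H y := by
  obtain ⟨u, hxu, huy⟩ := exists_between hxy
  obtain ⟨v, huv, hvy⟩ := exists_between huy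
  exact (hH.monotone.rightLim_le hxu).trans_lt ((hH huv).trans_le (hH.monotone.le_leftLim hvy))

/-- The generalized inverse of a strictly increasing function. -/
theorem exists_generalized_inverse (hH : StrictMono H) (h1 : ∀ y, H (y + 1) = H y + 1) :
    ∃ F : CircleDeg1Lift, Continuous F ∧
      ∀ z y, F z = y ↔ z ∈ Icc (leftLim H y) (rightLim H y) := by
  let HL : CircleDeg1Lift := ⟨⟨H, hH.monotone⟩, h1⟩
  have hex : ∀ z, ∃ y, z ∈ Icc (leftLim H y) (rightLim H y) := by
    intro z
    have hne : {y | H y ≤ z}.Nonempty :=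
      (HL.tendsto_atBot.eventually (eventually_le_atBot z)).exists
    obtain ⟨u, hu⟩ := (HL.tendsto_atTop.eventually (eventually_gt_atTop z)).exists
    have hbdd : BddAbove {y | H y ≤ z} := ⟨u, fun y hy =>
      (hH.lt_iff_lt.1 (lt_of_le_of_lt hy hu)).le⟩
    -- The intervals `[leftLim H y, rightLim H y]` tile the line, and `z` belongs to the one at this
    -- supremum.
    refine ⟨sSup {y | H y ≤ z}, le_of_tendsto (hH.monotone.tendsto_leftLim _) ?_,
      ge_of_tendsto (hH.monotone.tendsto_rightLim _) ?_⟩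
    · filter_upwards [self_mem_nhdsWithin] with x hx
      obtain ⟨y, hy, hxy⟩ := exists_lt_of_lt_csSup hne hx
      exact (hH hxy).le.trans hy
    · filter_upwards [self_mem_nhdsWithin] with x hx
      by_contra! hlt
      exact (le_csSup hbdd hlt.le).not_gt hx
  choose F hF using hex
  have huniq : ∀ {z y y'}, z ∈ Icc (leftLim H y) (rightLim H y) →
      z ∈ Icc (leftLim H y') (rightLim H y') → y = y' := by
    intro z y y' h h'
    rcases lt_trichotomy y y' with hlt | heq | hlt
    · exact absurd (hH.rightLim_lt_leftLim hlt) (h'.1.trans h.2).not_gt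
    · exact heq
    · exact absurd (hH.rightLim_lt_leftLim hlt) (h.1.trans h'.2).not_gt
  have hiff : ∀ z y, F z = y ↔ z ∈ Icc (leftLim H y) (rightLim H y) := fun z y =>
    ⟨fun h => h ▸ hF z, fun h => huniq (hF z) h⟩
  have hmono : Monotone F := by
    intro z z' hzz
    by_contra! hlt
    linarith [hH.rightLim_lt_leftLim hlt, (hF z).1, (hF z').2]
  refine ⟨⟨⟨F, hmono⟩, fun z => ?_⟩, ?_, hiff⟩
  · refine (hiff _ _).2 ?_
    rw [leftLim_add_one hH.monotone h1, rightLim_add_one hH.monotone h1]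
    exact ⟨by linarith [(hF z).1], by linarith [(hF z).2]⟩
  · exact hmono.continuous_of_surjective fun y => ⟨H y, (hiff _ _).2
      ⟨hH.monotone.leftLim_le le_rfl, hH.monotone.le_rightLim le_rfl⟩⟩

/-- The translation by `α` lifts along the generalized inverse to a homeomorphism of the line which
is affine on the fibres. -/
theorem exists_lift_translation (hH : StrictMono H) (h1 : ∀ y, H (y + 1) = H y + 1)
    {F : CircleDeg1Lift} (hF : ∀ z y, F z = y ↔ z ∈ Icc (leftLim H y) (rightLim H y)) {α : ℝ}
    (hα : ∀ y, leftLim H (y + α) < rightLim H (y + α) ↔ leftLim H y < rightLim H y) :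
    ∃ e : ℝ ≃o ℝ, (∀ z, e (z + 1) = e z + 1) ∧ ∀ z, F (e z) = F z + α := by
  have hmem : ∀ z, z ∈ Icc (leftLim H (F z)) (rightLim H (F z)) := fun z => (hF z _).1 rfl
  have hle : ∀ y, leftLim H y ≤ rightLim H y := fun y => hH.monotone.leftLim_le_rightLim le_rfl
  -- The fibre over `F z` is mapped affinely to the fibre over `F z + β`. On a degenerate fibre the
  -- quotient is `0 / 0 = 0`, which gives the left endpoint.
  let T : ℝ → ℝ → ℝ := fun β z => leftLim H (F z + β) +
    (z - leftLim H (F z)) / (rightLim H (F z) - leftLim H (F z)) *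
      (rightLim H (F z + β) - leftLim H (F z + β))
  have hFT : ∀ β z, F (T β z) = F z + β := by
    intro β z
    have ha : 0 ≤ z - leftLim H (F z) := sub_nonneg.2 (hmem z).1
    have hb : z - leftLim H (F z) ≤ rightLim H (F z) - leftLim H (F z) := by linarith [(hmem z).2]
    have hd := hle (F z + β)
    have h0 := div_nonneg ha (ha.trans hb)
    have h2 := div_le_one_of_le₀ hb (ha.trans hb)
    refine (hF _ _).2 ⟨?_, ?_⟩
    · exact le_add_of_nonneg_right (mul_nonneg h0 (sub_nonneg.2 hd))
    · have := mul_le_mul_of_nonneg_right h2 (sub_nonneg.2 hd)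
      simp only [T]
      linarith
  have hmono : ∀ β, Monotone (T β) := by
    intro β z z' hzz
    rcases (F.monotone hzz).eq_or_lt with heq | hlt
    · simp only [T, heq]
      have := hle (F z')
      have := hle (F z' + β)
      gcongr
    · exact (F.monotone.reflect_lt (by rw [hFT, hFT]; linarith)).le
  have hinv : ∀ β, (∀ y, leftLim H (y + β) < rightLim H (y + β) ↔ leftLim H y < rightLim H y) →
      ∀ z, T (-β) (T β z) = z := by
    intro β hβ z
    have e1 : T (-β) (T β z) = leftLim H (F z) + (T β z - leftLim H (F z + β)) /
        (rightLim H (F z + β) - leftLim H (F z + β)) *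
        (rightLim H (F z) - leftLim H (F z)) := by
      simp only [T]
      rw [show F _ = F z + β from hFT β z, add_neg_cancel_right]
    rw [e1]
    simp only [T, add_sub_cancel_left]
    rcases (hle (F z)).eq_or_lt with heq | hlt
    · have := hmem z
      rw [heq, sub_self, mul_zero, add_zero]
      rw [heq] at this
      exact le_antisymm this.1 this.2
    · have h2 := sub_ne_zero.2 hlt.ne'
      have h3 := sub_ne_zero.2 ((hβ (F z)).2 hlt).ne'
      rw [mul_div_cancel_right₀ _ h3, div_mul_cancel₀ _ h2]
      ring
  have hα' : ∀ y, leftLim H (y + -α) < rightLim H (y + -α) ↔ leftLim H y < rightLim H y :=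
    fun y => by rw [← hα (y + -α), neg_add_cancel_right]
  let e : ℝ ≃ ℝ := ⟨T α, T (-α), hinv α hα, fun z => by simpa using hinv (-α) hα' z⟩
  refine ⟨e.toOrderIso (hmono α) (hmono (-α)), fun z => ?_, hFT α⟩
  change T α (z + 1) = T α z + 1
  simp only [T, F.map_add_one, add_right_comm _ (1 : ℝ) α, leftLim_add_one hH.monotone h1,
    rightLim_add_one hH.monotone h1, add_sub_add_right_eq_sub]
  ring

end GeneralizedInverse

theorem exists_homeomorph_of_periodic_orderIso (e : ℝ ≃o ℝ) (h1 : ∀ z, e (z + 1) = e z + 1) :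
    ∃ f : UnitAddCircle ≃ₜ UnitAddCircle,
      ∀ z : ℝ, f (z : UnitAddCircle) = (e z : UnitAddCircle) := by
  have h1' : ∀ z, e.symm (z + 1) = e.symm z + 1 := fun z => by
    rw [e.symm_apply_eq, h1, e.apply_symm_apply]
  have hper : ∀ e : ℝ ≃o ℝ, (∀ z, e (z + 1) = e z + 1) →
      Function.Periodic (fun z : ℝ => (e z : UnitAddCircle)) 1 := fun e he z => by
    simp only [he, coe_add_one]
  have hcont : ∀ (e : ℝ ≃o ℝ) (he : ∀ z, e (z + 1) = e z + 1), Continuous (hper e he).lift := by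
    intro e he
    have hq : IsQuotientMap (fun x : ℝ => (x : UnitAddCircle)) :=
      isOpenMap_coe_circle.isQuotientMap continuous_coe_circle fun x =>
        (exists_coe_mem_Ico 0 x).imp fun _ ht => ht.2
    exact hq.continuous_iff.2 (continuous_coe_circle.comp e.continuous)
  refine ⟨⟨⟨(hper e h1).lift, (hper e.symm h1').lift, fun x => ?_, fun x => ?_⟩, hcont e h1,
    hcont e.symm h1'⟩, fun z => rfl⟩ <;>
  · obtain ⟨z, -, rfl⟩ := exists_coe_mem_Ico 0 x
    simp only [Function.Periodic.lift_coe, e.symm_apply_apply, e.apply_symm_apply]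

/-- Denjoy's construction, with two orbits blown up. -/
theorem exists_isDenjoyBlowUp (α : ℝ) (a b : UnitAddCircle) :
    ∃ (f : UnitAddCircle ≃ₜ UnitAddCircle) (p : UnitAddCircle → UnitAddCircle),
      IsDenjoyBlowUp α a b f p := by
  obtain ⟨A, -, rfl⟩ := exists_coe_mem_Ico 0 a
  obtain ⟨B, -, rfl⟩ := exists_coe_mem_Ico 0 b
  obtain ⟨H, hH, h1, hjump⟩ := exists_strictMono_jumps
    (Sum.elim (fun n : ℤ => A + n * α) (fun n : ℤ => B + n * α) : ℤ ⊕ ℤ → ℝ)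
  have hjump' : ∀ y, leftLim H y < rightLim H y ↔
      ∃ n : ℤ, (y : UnitAddCircle) = A + n • (α : UnitAddCircle) ∨
        (y : UnitAddCircle) = B + n • (α : UnitAddCircle) := by
    intro y
    rw [hjump, Sum.exists]
    simp only [Sum.elim_inl, Sum.elim_inr, ← AddCircle.coe_zsmul, ← AddCircle.coe_add,
      coe_eq_coe_iff_exists_int, zsmul_eq_mul, exists_or]
  obtain ⟨F, hF, hFiff⟩ := exists_generalized_inverse hH h1
  have hinvar : ∀ y, leftLim H (y + α) < rightLim H (y + α) ↔ leftLim H y < rightLim H y := by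
    intro y
    rw [hjump', hjump']
    constructor
    · rintro ⟨n, hn⟩
      refine ⟨n - 1, hn.imp (fun h => ?_) fun h => ?_⟩ <;>
      · rw [AddCircle.coe_add] at h
        rw [eq_sub_of_add_eq h, sub_zsmul, one_zsmul]
        abel
    · rintro ⟨n, hn⟩
      refine ⟨n + 1, hn.imp (fun h => ?_) fun h => ?_⟩ <;>
      · rw [AddCircle.coe_add, h, add_zsmul, one_zsmul]
        abel
  obtain ⟨e, he1, heF⟩ := exists_lift_translation hH h1 hFiff hinvar
  obtain ⟨f, hf⟩ := exists_homeomorph_of_periodic_orderIso e he1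
  have hper : Function.Periodic (fun t : ℝ => ((F t : ℝ) : UnitAddCircle)) 1 := fun t => by
    simp only [F.map_add_one, coe_add_one]
  have hp : ∀ t : ℝ, hper.lift (t : UnitAddCircle) = (F t : ℝ) := fun t =>
    Function.Periodic.lift_coe _ _
  have hnontriv : ∀ y : ℝ, leftLim H y < rightLim H y →
      (hper.lift ⁻¹' {(y : UnitAddCircle)}).Nontrivial := by
    intro y hy
    have hL : F (leftLim H y) = y := (hFiff _ _).2 ⟨le_rfl, hy.le⟩
    have hR : F (rightLim H y) = y := (hFiff _ _).2 ⟨hy.le, le_rfl⟩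
    refine ⟨(leftLim H y : ℝ), by simp [hp, hL], (rightLim H y : ℝ), by simp [hp, hR], ?_⟩
    intro heq
    -- A jump of `H` is shorter than one period, so its two ends remain distinct on the circle.
    have hlt := hH.rightLim_lt_leftLim (show y < y + 1 by linarith)
    rw [leftLim_add_one hH.monotone h1] at hlt
    exact hy.ne ((AddCircle.coe_eq_coe_iff_of_mem_Ico (p := (1 : ℝ)) (a := leftLim H y)
      ⟨le_rfl, by linarith⟩ ⟨hy.le, hlt⟩).1 heq)
  refine ⟨f, hper.lift, ⟨F, hF, hp⟩, fun x => ?_, fun n => ⟨?_, ?_⟩, fun y hy => ?_⟩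
  · obtain ⟨t, -, rfl⟩ := exists_coe_mem_Ico 0 x
    rw [hf, hp, hp, heF, AddCircle.coe_add]
  · rw [← AddCircle.coe_zsmul, ← AddCircle.coe_add]
    exact hnontriv _ ((hjump' _).2 ⟨n, Or.inl (by rw [AddCircle.coe_add, AddCircle.coe_zsmul])⟩)
  · rw [← AddCircle.coe_zsmul, ← AddCircle.coe_add]
    exact hnontriv _ ((hjump' _).2 ⟨n, Or.inr (by rw [AddCircle.coe_add, AddCircle.coe_zsmul])⟩)
  · obtain ⟨y, -, rfl⟩ := exists_coe_mem_Ico 0 y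
    rw [IsDenjoyBlowUp.fibre_eq_image hp]
    refine Set.Subsingleton.image (fun z hz z' hz' => ?_) _
    have heq : leftLim H y = rightLim H y :=
      (hH.monotone.leftLim_le_rightLim le_rfl).eq_or_lt.resolve_right fun hlt => by
        obtain ⟨n, hn⟩ := (hjump' y).1 hlt
        exact hn.elim (hy n).1 (hy n).2
    have h2 := (hFiff z y).1 hz
    have h3 := (hFiff z' y).1 hz'
    rw [heq] at h2 h3
    exact (le_antisymm h2.2 h2.1).trans (le_antisymm h3.2 h3.1).symm

end Construction

/-! ### The main theorem. -/

theorem mainTheorem2 (α : ℝ) (hα : Irrational α) (a b : UnitAddCircle)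
    (hab : ∀ n : ℤ, b ≠ a + n • (α : UnitAddCircle)) :
    (∃ (f : UnitAddCircle ≃ₜ UnitAddCircle) (p : UnitAddCircle → UnitAddCircle),
      IsDenjoyBlowUp α a b f p) ∧
    ∀ (f : UnitAddCircle ≃ₜ UnitAddCircle) (p : UnitAddCircle → UnitAddCircle),
      IsDenjoyBlowUp α a b f p →
      ∀ I J : ℤ → Set UnitAddCircle, I = blownInterval p α a → J = blownInterval p α b →
      ∀ K C₁ C₂ : Set UnitAddCircle, K = denjoySet I J →
        C₁ = K ∪ ⋃ n, I n → C₂ = K ∪ ⋃ n, J n →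
      -- the Denjoy homeomorphism, its Cantor set and its intervals
      IsCantorSet K ∧ f '' K = K ∧ IsMinimalSet {f} K ∧
      (∀ n, f '' I n = I (n + 1) ∧ f '' J n = J (n + 1)) ∧
      (∀ n, (∃ s t : ℝ, s < t ∧ t < s + 1 ∧ I n = arc s t) ∧
        ∃ s t : ℝ, s < t ∧ t < s + 1 ∧ J n = arc s t) ∧
      (∀ m n, (m ≠ n → Disjoint (I m) (I n) ∧ Disjoint (J m) (J n)) ∧ Disjoint (I m) (J n)) ∧
      IsCantorval C₁ ∧ IsCantorval C₂ ∧
      -- the further choices are possible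
      (∃ (v : UnitAddCircle → ℝ) (φ : Flow ℝ UnitAddCircle), (∃ L, LipschitzWith L v) ∧
        (∀ x, v x ≠ 0 ↔ x ∈ interior (I 0) ∪ interior (J 0)) ∧ IsFlowOf v φ) ∧
      (∃ (i' k i'' : ℤ) (p₁ p₂ q₁ q₂ p₁' p₂' : ℝ),
        IsCyclicTriple I J i' k i'' p₁ p₂ q₁ q₂ p₁' p₂') ∧
      (∀ (i' k i'' : ℤ) (p₁ p₂ q₁ q₂ p₁' p₂' : ℝ),
        IsCyclicTriple I J i' k i'' p₁ p₂ q₁ q₂ p₁' p₂' →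
        ∃ g : UnitAddCircle ≃ₜ UnitAddCircle, IsPushMap (J k) p₁ p₂ p₁' p₂' g) ∧
      -- whatever the choices, the minimal sets are the two Cantorvals
      ∀ (v : UnitAddCircle → ℝ) (φ : Flow ℝ UnitAddCircle), Continuous v →
        (∀ x, v x ≠ 0 ↔ x ∈ interior (I 0) ∪ interior (J 0)) → IsFlowOf v φ →
        ∀ (i' k i'' : ℤ) (p₁ p₂ q₁ q₂ p₁' p₂' : ℝ),
        IsCyclicTriple I J i' k i'' p₁ p₂ q₁ q₂ p₁' p₂' →
        ∀ g : UnitAddCircle ≃ₜ UnitAddCircle, IsPushMap (J k) p₁ p₂ p₁' p₂' g →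
        ∀ G : Subsemigroup (UnitAddCircle ≃ₜ UnitAddCircle),
          G = exampleSemigroup f (φ.toHomeomorph 1) (φ.toHomeomorph (-√2)) g →
        g '' C₂ ⊆ C₂ ∧ C₁ ⊆ g '' C₁ ∧
        (∀ M, IsForwardMinimal G M ↔ M = C₂) ∧
        (∀ M, IsBackwardMinimal G M ↔ M = C₁) ∧
        (∀ x, C₂ ⊆ closure {y | ∃ h ∈ G, y = h x}) ∧
        (∀ x, C₁ ⊆ closure {y | ∃ h ∈ G, x = h y}) ∧
        ¬ C₁ ⊆ C₂ ∧ ¬ C₂ ⊆ C₁ ∧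
        ¬ IsForwardMinimal G univ ∧ ¬ IsBackwardMinimal G univ := by
  refine ⟨exists_isDenjoyBlowUp α a b, ?_⟩
  rintro f p h I J rfl rfl K C₁ C₂ rfl rfl rfl
  have hab' : ∀ n : ℤ, a ≠ b + n • (α : UnitAddCircle) := fun n hn =>
    hab (-n) (by rw [hn, neg_zsmul]; abel)
  have hcomm := denjoySet_comm (blownInterval p α a) (blownInterval p α b)
  have hC₁ := IsDenjoyBlowUp.denjoySet_union (p := p) hab
  have hC₂ := IsDenjoyBlowUp.denjoySet_union (p := p) hab'
  have hval₁ := h.isCantorval_union hα hab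
  have hval₂ := h.symm.isCantorval_union hα hab'
  rw [← hcomm] at hC₂ hval₂
  refine ⟨h.isCantorSet_denjoySet hα, h.image_denjoySet, h.isMinimalSet_denjoySet hα,
    fun n => ⟨h.image_blownInterval a n, h.image_blownInterval b n⟩,
    fun n => ⟨h.exists_blownInterval_eq_arc n, h.symm.exists_blownInterval_eq_arc n⟩,
    fun m n => ⟨fun hmn => ⟨IsDenjoyBlowUp.disjoint_blownInterval hα a hmn,
      IsDenjoyBlowUp.disjoint_blownInterval hα b hmn⟩,
      IsDenjoyBlowUp.disjoint_blownInterval_of_ne hab m n⟩,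
    hval₁, hval₂, ?_, h.exists_cyclicTriple hα hab,
    fun _ _ _ _ _ _ _ _ _ ht => ht.exists_pushMap, ?_⟩
  · refine exists_lipschitz_field (isOpen_interior.union isOpen_interior) fun hu => ?_
    obtain ⟨x, hx⟩ := (h.isCantorSet_denjoySet hα).1
    exact hx (mem_iUnion.2 ⟨0, hu ▸ mem_univ x⟩)
  · rintro v φ hvc hv hφ i' k i'' p₁ p₂ q₁ q₂ p₁' p₂' ht g hg G rfl
    have hfG : f ∈ exampleSemigroup f (φ.toHomeomorph 1) (φ.toHomeomorph (-√2)) g :=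
      Subsemigroup.subset_closure (by simp)
    have hfwd : ∀ e ∈ exampleSemigroup f (φ.toHomeomorph 1) (φ.toHomeomorph (-√2)) g,
        e '' (denjoySet (blownInterval p α a) (blownInterval p α b) ∪
          ⋃ n, blownInterval p α b n) ⊆ denjoySet (blownInterval p α a) (blownInterval p α b) ∪
          ⋃ n, blownInterval p α b n := fun e he => by
      rw [hC₂]
      exact h.forward_invariant hα hab hφ hv ht hg he
    have hbwd : ∀ e, e⁻¹ ∈ exampleSemigroup f (φ.toHomeomorph 1) (φ.toHomeomorph (-√2)) g →
        e '' (denjoySet (blownInterval p α a) (blownInterval p α b) ∪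
          ⋃ n, blownInterval p α a n) ⊆ denjoySet (blownInterval p α a) (blownInterval p α b) ∪
          ⋃ n, blownInterval p α a n := fun e he => by
      rw [hC₁]
      rintro _ ⟨x, hx, rfl⟩
      obtain ⟨y, hy, rfl⟩ := h.backward_invariant hα hab hφ hv ht hg he hx
      rwa [show e (e⁻¹ y) = y from e.apply_symm_apply y]
    have hmin₂ := fun N : Set UnitAddCircle =>
      h.subset_of_forward_invariant hα hab hφ hvc hv ht hg (N := N)
    have hmin₁ := fun N : Set UnitAddCircle =>
      h.subset_of_backward_invariant hα hab hφ hvc hv ht hg (N := N)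
    have hF : ∀ M, IsForwardMinimal (exampleSemigroup f (φ.toHomeomorph 1)
        (φ.toHomeomorph (-√2)) g) M ↔ M = denjoySet (blownInterval p α a) (blownInterval p α b) ∪
          ⋃ n, blownInterval p α b n := fun M =>
      isMinimalSet_iff_eq hval₂.1 hval₂.2.2.1.isClosed hfwd hmin₂
    have hB : ∀ M, IsBackwardMinimal (exampleSemigroup f (φ.toHomeomorph 1)
        (φ.toHomeomorph (-√2)) g) M ↔ M = denjoySet (blownInterval p α a) (blownInterval p α b) ∪
          ⋃ n, blownInterval p α a n := fun M =>
      isMinimalSet_iff_eq hval₁.1 hval₁.2.2.1.isClosed hbwd hmin₁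
    refine ⟨hfwd g (Subsemigroup.subset_closure (by simp)), ?_, hF, hB, fun x => ?_, fun x => ?_,
      fun hsub => ?_, fun hsub => ?_, fun hu => hval₂.2.1 ((hF _).1 hu).symm,
      fun hu => hval₁.2.1 ((hB _).1 hu).symm⟩
    · rw [hC₁]
      exact hg.subset_image_compl ht (IsDenjoyBlowUp.disjoint_blownInterval_of_ne hab)
    · exact hmin₂ _ ⟨f x, subset_closure ⟨f, hfG, rfl⟩⟩ isClosed_closure
        fun e he => closure_orbit_invariant _ x he
    · exact hmin₁ _ ⟨f.symm x, subset_closure ⟨f, hfG, (f.apply_symm_apply x).symm⟩⟩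
        isClosed_closure fun e he => closure_backward_orbit_invariant _ x he
    -- An interior point of `I 0` belongs to `C₁` but lies in a gap of `C₂`; the other non-inclusion
    -- uses `J 0`.
    · obtain ⟨x, hx⟩ := h.interior_blownInterval_nonempty 0
      rw [hC₂] at hsub
      exact hsub (Or.inr (mem_iUnion.2 ⟨0, interior_subset hx⟩)) (mem_iUnion.2 ⟨0, hx⟩)
    · obtain ⟨x, hx⟩ := h.symm.interior_blownInterval_nonempty 0
      rw [hC₁] at hsub
      exact hsub (Or.inr (mem_iUnion.2 ⟨0, interior_subset hx⟩)) (mem_iUnion.2 ⟨0, hx⟩)
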